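/- Let $n\ge 0$ and $m,k,d\ge 1$ be integers, let $f_1,\dots,f_m\in\mathbb{C}[x_0,\dots,x_n]$ be homogeneous polynomials of the same degree $d$ (zero polynomials are allowed), and let $V=\mathbb{V}(f_1,\dots,f_m)\subset\mathbb{P}^n$ be their common zero locus in complex projective space. For a matrix $\Lambda=[\lambda_{ij}]\in\mathbb{C}^{k\times m}$ let $\mathbb{V}(\Lambda_{\boldsymbol f})\subset\mathbb{P}^n$ denote the common zero locus of the $k$ linear combinations $\lambda_{i1}f_1+\dots+\lambda_{im}f_m$, $1\le i\le k$. Then there is a hypersurface $H\subset\mathbb{C}^{k\times m}$ (the zero set of a nonconstant squarefree polynomial in the matrix entries, whose total degree is the degree of $H$) of degree at most $k\,d^{k-1}$ such that for every $\Lambda\in\mathbb{C}^{k\times m}\setminus H$, every irreducible component of $\mathbb{V}(\Lambda_{\boldsymbol f})$ either is an irreducible component of $V$ or has dimension $n-k$ (if $k>n$, this says that every irreducible component of $\mathbb{V}(\Lambda_{\boldsymbol f})$ is an irreducible component of $V$). In particular, this holds for a generic $\Lambda\in\mathbb{C}^{k\times m}$. Here the dimension of a variety $Y\subset\mathbb{P}^n$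 is the integer $r$ such that every linear subspace of $\mathbb{P}^n$ of dimension at least $n-r$ meets $Y$ and a generic linear subspace of dimension at most $n-r-1$ is disjoint from $Y$. -/

import Mathlib

namespace ProjVar

open MvPolynomial

/-- Complex projective space `ℙⁿ`, with homogeneous coordinates `x₀, …, xₙ`. -/
abbrev PSpace (n : ℕ) : Type := Projectivization ℂ (Fin (n + 1) → ℂ)

/-- The common zero locus in `ℙⁿ` of a set `S` of polynomials. It is used for homogeneous polynomials
only, where it does not depend on the chosen representatives (see `eval_rep_eq_zero_iff`). -/
def zeroLocus {n : ℕ} (S : Set (MvPolynomial (Fin (n + 1)) ℂ)) : Set (PSpace n) :=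
  {p | ∀ F ∈ S, eval p.rep F = 0}

/-- The vanishing of a homogeneous polynomial at a point of `ℙⁿ` may be tested on any
homogeneous coordinate vector of the point. -/
theorem eval_rep_eq_zero_iff {n e : ℕ} {F : MvPolynomial (Fin (n + 1)) ℂ}
    (hF : F.IsHomogeneous e) (v : Fin (n + 1) → ℂ) (hv : v ≠ 0) :
    eval (Projectivization.mk ℂ v hv).rep F = 0 ↔ eval v F = 0 := by
  obtain ⟨a, ha⟩ := Projectivization.exists_smul_eq_mk_rep ℂ v hv
  rw [← ha]
  have h : eval (a • v) F = (a : ℂ) ^ e * eval v F := by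
    rw [eval_eq', eval_eq', Finset.mul_sum]
    refine Finset.sum_congr rfl fun m hm => ?_
    have hdeg : ∑ i, m i = e := by
      have := hF (mem_support_iff.mp hm)
      rwa [Finsupp.weight_apply, Finsupp.sum_fintype _ _ (by simp), Finset.sum_congr rfl
        (fun i _ => by simp : ∀ i ∈ Finset.univ, m i • (1 : Fin (n + 1) → ℕ) i = m i)] at this
    simp only [Pi.smul_apply, Units.smul_def, smul_eq_mul, mul_pow, Finset.prod_mul_distrib,
      Finset.prod_pow_eq_pow_sum, hdeg]
    ring
  rw [h]
  simp

/-- A projective subvariety of `ℙⁿ`: the zero locus of a set of homogeneous polynomials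
(by Hilbert's basis theorem a finite set would do). It may be empty or reducible. -/
def IsVariety {n : ℕ} (Y : Set (PSpace n)) : Prop :=
  ∃ S : Set (MvPolynomial (Fin (n + 1)) ℂ),
    (∀ F ∈ S, ∃ e : ℕ, F.IsHomogeneous e) ∧ Y = zeroLocus S

/-- An irreducible projective variety: a nonempty variety that is not the union of two
proper subvarieties. -/
def IsIrredVariety {n : ℕ} (Y : Set (PSpace n)) : Prop :=
  IsVariety Y ∧ Y.Nonempty ∧
    ∀ A B : Set (PSpace n), IsVariety A → IsVariety B → Y = A ∪ B → Y = A ∨ Y = B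

/-- `Y` is an irreducible component of `W`: a maximal irreducible variety contained in `W`. -/
def IsComponent {n : ℕ} (Y W : Set (PSpace n)) : Prop :=
  Maximal (fun Z : Set (PSpace n) => IsIrredVariety Z ∧ Z ⊆ W) Y

/-- `Y` meets the projective linear subspace `ℙ(L)`, of dimension `finrank L - 1`. -/
def Meets {n : ℕ} (Y : Set (PSpace n)) (L : Submodule ℂ (Fin (n + 1) → ℂ)) : Prop :=
  ∃ p ∈ Y, p.submodule ≤ L

/-- `Y ⊆ ℙⁿ` has dimension `r`: every linear subspace of dimension at least `n - r` meets `Y`,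
and a generic linear subspace of dimension at most `n - r - 1` is disjoint from `Y`. A subspace
of dimension `n - c` is written as the kernel of a `c × (n + 1)` matrix, and "generic" means:
whenever some nonzero polynomial in the entries of the matrix does not vanish. -/
def HasDim {n : ℕ} (Y : Set (PSpace n)) (r : ℕ) : Prop :=
  (∀ L : Submodule ℂ (Fin (n + 1) → ℂ), n + 1 ≤ Module.finrank ℂ L + r → Meets Y L) ∧
  (∀ c : ℕ, r + 1 ≤ c → c ≤ n + 1 →
    ∃ Q : MvPolynomial (Fin c × Fin (n + 1)) ℂ, Q ≠ 0 ∧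
      ∀ u : Matrix (Fin c) (Fin (n + 1)) ℂ, eval (fun ij => u ij.1 ij.2) Q ≠ 0 →
        ¬ Meets Y (LinearMap.ker u.mulVecLin))

/-- The variety `𝕍(f₁, …, f_m) ⊆ ℙⁿ`. -/
def projV {n m : ℕ} (f : Fin m → MvPolynomial (Fin (n + 1)) ℂ) : Set (PSpace n) :=
  zeroLocus (Set.range f)

/-- The system `Λ_f` of the `k` linear combinations `∑ⱼ λᵢⱼ fⱼ`. -/
noncomputable def linComb {n m k : ℕ} (Λ : Matrix (Fin k) (Fin m) ℂ)
    (f : Fin m → MvPolynomial (Fin (n + 1)) ℂ) : Fin k → MvPolynomial (Fin (n + 1)) ℂ :=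
  fun i => ∑ j, Λ i j • f j

/-- `H` is a hypersurface of degree `e` in the affine space of `k × m` matrices: the zero set of
a nonconstant squarefree polynomial of total degree `e` in the entries. -/
def IsHypersurfaceOfDegree {k m : ℕ} (H : Set (Matrix (Fin k) (Fin m) ℂ)) (e : ℕ) : Prop :=
  ∃ P : MvPolynomial (Fin k × Fin m) ℂ, Squarefree P ∧ 0 < P.totalDegree ∧ P.totalDegree = e ∧
    H = {Λ | eval (fun ij => Λ ij.1 ij.2) P = 0}

end ProjVar

/-!
Write `s = k - 1` and let `Ŷ ⊆ ℂⁿ⁺¹` be the affine cone over a component `Y` of the zero locus of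
the `k` combinations `Λ_f`. Everything is measured by the least number `r` of linear forms without
a common zero on `Y`, which is one more than the dimension of `Y`.

*Lower bound* (`le_add_of_isComponent`). If `c` linear forms have no common zero on `Y`, then
`n + 1 ≤ k + c`: at a point of `Ŷ` on no other component, the `k` combinations and `c` translated
linear forms cut out that point locally, and Krull's height theorem applies.

*Upper bound* (`eval_obstruction_eq_zero`). Suppose that `Y` is not contained in `V` and that
`r + k ≥ n + 2`. The `r` linear forms are algebraically independent on `Ŷ`
(`eq_zero_of_aeval_linForm_mem`), so the generic point of `Ŷ` lies on a generic affine space of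
dimension `s`, in the sense that the entries of the matrix `M` parametrising this space are
algebraically independent over `ℂ` (`exists_independent_sub_linear`,
`exists_independent_parametrization`). Restricted to that space the `f j` are polynomials of
degree at most `d` in `s` variables, and the `s + 1` combinations given by `Λ` have a common zero
at which not all `f j` vanish. The matrices for which this happens satisfy an equation of degree
at most `(s + 1) * d ^ s`, whose coefficients are polynomials in `M` (`exists_obstruction`). As
the entries of `M` are independent, the equation holds identically in `M`, hence at a fixed `M`
chosen in advance, independently of `Y`. At this fixed `M` the equation defines the hypersurface
`H`, or has no solutions, in which case any hyperplane will do.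

*Degree of the equation* (`exists_chowForm`). If the `g j`, among them the powers `x_l ^ d`, have
degree at most `d` in `s` variables, then the pairs `(λ, t)` for which the `s + 1` polynomials
`t i + ∑ j, λ i j * g j` have a common zero satisfy one irreducible equation `P = 0`, and `P`
divides every other polynomial vanishing on such pairs (`dvd_of_chowSubst_eq_zero`). For every `i` there
is such a polynomial of degree at most `d ^ s` in the coefficients of the `i`-th row: the norm of
the `i`-th combination over the subalgebra generated by the other `s` (`exists_norm`). The degree
bound for the norm is a Bézout bound, proved by counting monomials (`le_pow_of_independent`). So
`P` has degree at most `d ^ s` in each of the `s + 1` rows. To apply this to the restrictions of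
the `f j`, the powers `x_l ^ d` are added to them with coefficients proportional to a parameter,
and the term of `P` of lowest order in the parameter is taken (`exists_obstruction`).
-/

namespace ProjVar

open MvPolynomial

/-! ### A Bézout bound by counting monomials -/

/-- The exponents of monomials in `s` variables of total degree at most `N`. -/
def degLE (s N : ℕ) : Finset (Fin s →₀ ℕ) :=
  (Finset.range (N + 1)).biUnion fun e => Finset.finsuppAntidiag Finset.univ e

theorem mem_degLE {s N : ℕ} {a : Fin s →₀ ℕ} : a ∈ degLE s N ↔ a.degree ≤ N := by
  simp [degLE, Finset.mem_finsuppAntidiag, Finsupp.degree_eq_sum]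

theorem card_degLE (s N : ℕ) : (degLE s N).card = (N + s).choose s := by
  rw [degLE, Finset.card_biUnion]
  · simp only [Finset.card_finsuppAntidiag_nat_eq_choose, Finset.card_univ, Fintype.card_fin]
    cases s with
    | zero =>
      rw [Finset.sum_range_succ']
      simp
    | succ s =>
      rw [← add_assoc, ← Nat.sum_range_add_choose]
      refine Finset.sum_congr rfl fun i _ => ?_
      rw [show s + 1 + i - 1 = i + s by omega, ← Nat.choose_symm_add]
  · intro i _ j _ hij
    rw [Function.onFun, Finset.disjoint_left]
    intro a ha hb
    rw [Finset.mem_finsuppAntidiag] at ha hb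
    exact hij (ha.1.symm.trans hb.1)

/-- Both sides grow like `N ^ s`, with leading coefficients `t / s!` and `d ^ s / s!`. -/
theorem le_pow_of_forall_mul_choose_le {t d s E : ℕ}
    (h : ∀ N : ℕ, t * (N + s).choose s ≤ (d * N + E + s).choose s) : t ≤ d ^ s := by
  have h1 : ∀ N : ℕ, t * N ^ s ≤ (d * N + (E + s)) ^ s := by
    intro N
    have h2 : t * (N + 1).ascFactorial s ≤ (d * N + E + 1).ascFactorial s := by
      rw [Nat.ascFactorial_eq_factorial_mul_choose, Nat.ascFactorial_eq_factorial_mul_choose]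
      calc _ = s.factorial * (t * (N + s).choose s) := by ring
        _ ≤ _ := Nat.mul_le_mul_left _ (h N)
    calc t * N ^ s ≤ t * (N + 1) ^ s := by gcongr; omega
      _ ≤ t * (N + 1).ascFactorial s := by gcongr; exact Nat.pow_succ_le_ascFactorial _ _
      _ ≤ _ := h2
      _ ≤ (d * N + E + s) ^ s := Nat.ascFactorial_le_pow_add _ _
      _ = _ := by rw [add_assoc]
  have h3 : ∀ᶠ N : ℕ in Filter.atTop, (t : ℝ) ≤ (d + (E + s : ℕ) / (N : ℝ)) ^ s := by
    filter_upwards [Filter.eventually_gt_atTop 0] with N hN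
    have hN' : (0 : ℝ) < N := by exact_mod_cast hN
    have h4 : (t : ℝ) * N ^ s ≤ (d * N + (E + s : ℕ)) ^ s := by exact_mod_cast h1 N
    have h5 : (d + (E + s : ℕ) / (N : ℝ)) = (d * N + (E + s : ℕ)) / N := by field_simp
    rw [h5, div_pow, le_div_iff₀ (by positivity)]
    exact h4
  have h6 : Filter.Tendsto (fun N : ℕ => ((d : ℝ) + (E + s : ℕ) / (N : ℝ)) ^ s) Filter.atTop
      (nhds (((d : ℝ) + 0) ^ s)) :=
    (tendsto_const_nhds.add (tendsto_const_div_atTop_nhds_zero_nat _)).pow s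
  have h7 := ge_of_tendsto h6 h3
  rw [add_zero] at h7
  exact_mod_cast h7

theorem totalDegree_aeval_monomial_le {R : Type*} [CommRing R] {s d : ℕ}
    {y : Fin s → MvPolynomial (Fin s) R} (hy : ∀ i, (y i).totalDegree ≤ d) (a : Fin s →₀ ℕ) :
    (aeval y (monomial a (1 : R))).totalDegree ≤ d * a.degree := by
  rw [aeval_monomial, map_one, one_mul, Finsupp.prod_fintype _ _ (by simp), Finsupp.degree_eq_sum,
    Finset.mul_sum]
  refine (totalDegree_finsetProd _ _).trans (Finset.sum_le_sum fun i _ => ?_)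
  refine (totalDegree_pow _ _).trans ?_
  rw [mul_comm]
  exact Nat.mul_le_mul_right _ (hy i)

/-- A Bézout bound, obtained by counting monomials: over the subalgebra generated by `s`
polynomials of degree at most `d`, the polynomial ring in `s` variables has rank at most `d ^ s`. -/
theorem le_pow_of_independent {R : Type*} [CommRing R] [IsDomain R] {s d t : ℕ}
    {y : Fin s → MvPolynomial (Fin s) R} (hy : ∀ i, (y i).totalDegree ≤ d)
    {b : Fin t → MvPolynomial (Fin s) R}
    (hb : ∀ c : Fin t → MvPolynomial (Fin s) R, ∑ r, aeval y (c r) * b r = 0 → c = 0) :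
    t ≤ d ^ s := by
  set E : ℕ := Finset.univ.sup fun r => (b r).totalDegree with hE
  refine le_pow_of_forall_mul_choose_le (E := E) fun N => ?_
  let v : Fin t × degLE s N → degLE s (d * N + E) → R := fun ra m =>
    coeff m.1 (aeval y (monomial ra.2.1 (1 : R)) * b ra.1)
  have hv : LinearIndependent R v := by
    rw [Fintype.linearIndependent_iff]
    intro c hc
    let q : Fin t → MvPolynomial (Fin s) R := fun r =>
      ∑ a : degLE s N, c (r, a) • monomial a.1 (1 : R)
    have hsum : ∑ r, aeval y (q r) * b r
        = ∑ ra : Fin t × degLE s N, c ra • (aeval y (monomial ra.2.1 (1 : R)) * b ra.1) := by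
      rw [Fintype.sum_prod_type]
      refine Finset.sum_congr rfl fun r _ => ?_
      simp only [q, map_sum, map_smul, Finset.sum_mul, smul_mul_assoc]
    have hzero : ∑ r, aeval y (q r) * b r = 0 := by
      rw [hsum]
      ext m
      rw [coeff_zero]
      by_cases hm : m ∈ degLE s (d * N + E)
      · have := congrFun hc ⟨m, hm⟩
        simpa [v, coeff_sum, Finset.sum_apply] using this
      · rw [mem_degLE, not_le] at hm
        refine coeff_eq_zero_of_totalDegree_lt (lt_of_le_of_lt ?_ hm)
        refine totalDegree_finsetSum_le fun ra _ => ?_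
        refine (totalDegree_smul_le _ _).trans ((totalDegree_mul _ _).trans ?_)
        refine add_le_add ((totalDegree_aeval_monomial_le hy _).trans ?_) ?_
        · exact Nat.mul_le_mul_left _ (mem_degLE.1 ra.2.2)
        · exact Finset.le_sup (f := fun r => (b r).totalDegree) (Finset.mem_univ _)
    have hq := hb q hzero
    rintro ⟨r, a⟩
    have h1 : coeff a.1 (q r) = 0 := by rw [hq]; simp
    have h2 : coeff a.1 (q r) = c (r, a) := by
      simp only [q, coeff_sum, coeff_smul, coeff_monomial, smul_eq_mul, mul_ite, mul_one, mul_zero]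
      rw [Finset.sum_eq_single a]
      · simp
      · intro a' _ ha'
        rw [if_neg (fun h => ha' (Subtype.ext h))]
      · simp
    rw [← h2, h1]
  have := hv.fintype_card_le_finrank
  rw [Module.finrank_fintype_fun_eq_card, Fintype.card_prod, Fintype.card_fin, Fintype.card_coe,
    Fintype.card_coe, card_degLE, card_degLE] at this
  exact this

/-! ### Norms -/

/-- A maximal family among those independent over the subalgebra generated by `y`; by the Bézout
bound it has at most `d ^ s` members. Every element of the polynomial ring becomes a combination
of its members after multiplication by a nonzero element of the subalgebra. -/
theorem exists_maximal_independent {R : Type*} [CommRing R] [IsDomain R] {s d : ℕ}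
    {y : Fin s → MvPolynomial (Fin s) R} (hy : ∀ i, (y i).totalDegree ≤ d)
    (hinj : ∀ p : MvPolynomial (Fin s) R, aeval y p = 0 → p = 0) :
    ∃ (t : ℕ) (b : Fin t → MvPolynomial (Fin s) R), 0 < t ∧ t ≤ d ^ s ∧
      (∀ c : Fin t → MvPolynomial (Fin s) R, ∑ r, aeval y (c r) * b r = 0 → c = 0) ∧
      ∀ z : MvPolynomial (Fin s) R, ∃ (c : MvPolynomial (Fin s) R)
        (e : Fin t → MvPolynomial (Fin s) R), c ≠ 0 ∧
          aeval y c * z = ∑ r, aeval y (e r) * b r := by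
  classical
  let Ind : ℕ → Prop := fun t => ∃ b : Fin t → MvPolynomial (Fin s) R,
    ∀ c : Fin t → MvPolynomial (Fin s) R, ∑ r, aeval y (c r) * b r = 0 → c = 0
  have hbound : ∀ t, Ind t → t ≤ d ^ s := fun t ⟨b, hb⟩ => le_pow_of_independent hy hb
  have hone : Ind 1 := by
    refine ⟨fun _ => 1, fun c hc => ?_⟩
    ext1 r
    rw [Subsingleton.elim r 0]
    exact hinj _ (by simpa using hc)
  let t := Nat.findGreatest Ind (d ^ s)
  have ht1 : 1 ≤ t := Nat.le_findGreatest (hbound 1 hone) hone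
  obtain ⟨b, hb⟩ : Ind t := Nat.findGreatest_spec (hbound 1 hone) hone
  refine ⟨t, b, ht1, Nat.findGreatest_le _, hb, fun z => ?_⟩
  by_contra! hcon
  have hsucc : Ind (t + 1) := by
    refine ⟨Fin.cons z b, fun c hc => ?_⟩
    rw [Fin.sum_univ_succ] at hc
    simp only [Fin.cons_zero, Fin.cons_succ] at hc
    have hc0 : c 0 = 0 := by
      by_contra h0
      refine hcon (c 0) (fun r => - c r.succ) h0 ?_
      simp only [map_neg, neg_mul, Finset.sum_neg_distrib]
      linear_combination hc
    rw [hc0, map_zero, zero_mul, zero_add] at hc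
    have h2 := hb _ hc
    ext1 r
    refine Fin.cases hc0 (fun i => ?_) r
    exact congrFun h2 i
  have := Nat.le_findGreatest (hbound _ hsucc) hsucc
  change t + 1 ≤ t at this
  omega

theorem totalDegree_det_le {τ R : Type*} [CommRing R] {t : ℕ}
    (M : Matrix (Fin t) (Fin t) (MvPolynomial τ R)) (hM : ∀ i j, (M i j).totalDegree ≤ 1) :
    M.det.totalDegree ≤ t := by
  rw [Matrix.det_apply]
  refine totalDegree_finsetSum_le fun σ _ => ?_
  refine (totalDegree_smul_le _ _).trans ?_
  refine (totalDegree_finsetProd _ _).trans ?_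
  refine (Finset.sum_le_sum fun i _ => hM _ _).trans ?_
  simp

/-- The norm, up to a denominator, of the general combination `X_none + ∑ X_j a_j` from the
polynomial ring down to the subalgebra generated by `y`: it vanishes when the combination does, and
its degree in the coefficients of the combination is at most `d ^ s`. -/
theorem exists_norm {R : Type*} [CommRing R] [IsDomain R] {s d : ℕ} {J : Type*} [Fintype J]
    {y : Fin s → MvPolynomial (Fin s) R} (hy : ∀ i, (y i).totalDegree ≤ d)
    (hinj : ∀ p : MvPolynomial (Fin s) R, aeval y p = 0 → p = 0)
    (a : J → MvPolynomial (Fin s) R) :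
    ∃ Q : MvPolynomial (Option J) (MvPolynomial (Fin s) R), Q ≠ 0 ∧ Q.totalDegree ≤ d ^ s ∧
      eval₂Hom ((C : MvPolynomial (Fin s) R →+* MvPolynomial J (MvPolynomial (Fin s) R)).comp
          (aeval (R := R) y).toRingHom)
        (fun o : Option J => o.elim (-∑ j, X j * C (a j)) X) Q = 0 := by
  classical
  obtain ⟨t, b, ht, htd, hb, hspan⟩ := exists_maximal_independent hy hinj
  choose c e hc he using fun jr : J × Fin t => hspan (a jr.1 * b jr.2)
  set c' := ∏ jr, c jr with hc'
  have hc'0 : c' ≠ 0 := Finset.prod_ne_zero_iff.2 fun jr _ => hc jr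
  -- clear denominators so that one `c'` serves all products `a j * b r`
  have key : ∀ j r, ∃ A : Fin t → MvPolynomial (Fin s) R,
      aeval y c' * (a j * b r) = ∑ r', aeval y (A r') * b r' := by
    intro j r
    refine ⟨fun r' => (∏ jr ∈ Finset.univ.erase (j, r), c jr) * e (j, r) r', ?_⟩
    rw [hc', ← Finset.mul_prod_erase _ _ (Finset.mem_univ (j, r))]
    simp only [map_mul, mul_assoc]
    rw [← Finset.mul_sum, ← he (j, r)]
    ring
  choose A hA using key
  let M : Matrix (Fin t) (Fin t) (MvPolynomial (Option J) (MvPolynomial (Fin s) R)) :=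
    Matrix.of fun r r' => X none * C (if r = r' then c' else 0) + ∑ j, X (some j) * C (A j r r')
  have hXC : ∀ (o : Option J) (q : MvPolynomial (Fin s) R),
      (X o * C q : MvPolynomial (Option J) (MvPolynomial (Fin s) R)).totalDegree ≤ 1 := by
    intro o q
    refine (totalDegree_mul _ _).trans ?_
    rw [totalDegree_C, totalDegree_X, add_zero]
  refine ⟨M.det, ?_, (totalDegree_det_le M fun r r' => ?_).trans htd, ?_⟩
  · intro h0
    have h1 := congrArg (eval fun o : Option J => o.elim (1 : MvPolynomial (Fin s) R) 0) h0
    rw [RingHom.map_det, map_zero] at h1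
    have h2 : (eval fun o : Option J => o.elim (1 : MvPolynomial (Fin s) R) 0).mapMatrix M
        = Matrix.diagonal fun _ => c' := by
      ext1 r r'
      simp [M, Matrix.diagonal_apply]
    rw [h2, Matrix.det_diagonal, Finset.prod_const] at h1
    exact hc'0 (pow_eq_zero_iff (by simpa using ht.ne') |>.1 h1)
  · refine (totalDegree_add _ _).trans (max_le (hXC _ _) ?_)
    exact totalDegree_finsetSum_le fun j _ => hXC _ _
  · set φ := eval₂Hom ((C : MvPolynomial (Fin s) R →+* MvPolynomial J (MvPolynomial (Fin s) R)).comp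
          (aeval (R := R) y).toRingHom) (fun o : Option J => o.elim (-∑ j, X j * C (a j)) X) with hφ
    have hφC : ∀ q, φ (C q) = C (aeval y q) := fun q => eval₂Hom_C _ _ _
    have hφs : ∀ j, φ (X (some j)) = X j := fun j => eval₂Hom_X' _ _ _
    have hφn : φ (X none) = -∑ j, X j * C (a j) := eval₂Hom_X' _ _ _
    rw [RingHom.map_det]
    refine Matrix.exists_mulVec_eq_zero_iff.1 ⟨fun r => C (b r), fun h => ?_, ?_⟩
    · have h1 : b ⟨0, ht⟩ = 0 := by simpa using congrFun h ⟨0, ht⟩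
      have h2 := hb (Pi.single ⟨0, ht⟩ 1) (by
        rw [Finset.sum_eq_single ⟨0, ht⟩]
        · rw [h1, mul_zero]
        · intro r _ hr
          rw [Pi.single_eq_of_ne hr, map_zero, zero_mul]
        · simp)
      simpa using congrFun h2 ⟨0, ht⟩
    · ext1 r
      have h1 : ∀ j, (∑ r', C (aeval y (A j r r')) * C (b r') :
          MvPolynomial J (MvPolynomial (Fin s) R)) = C (aeval y c' * (a j * b r)) := by
        intro j
        rw [hA, map_sum]
        simp only [map_mul]
      simp only [Matrix.mulVec, dotProduct, RingHom.mapMatrix_apply, Matrix.map_apply, M,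
        Matrix.of_apply, map_add, map_mul, map_sum, hφC, hφs, hφn, Pi.zero_apply, add_mul,
        Finset.sum_add_distrib, Finset.sum_mul, mul_assoc]
      rw [Finset.sum_comm (s := Finset.univ (α := Fin t)) (t := Finset.univ (α := J))]
      simp only [← Finset.mul_sum, h1]
      rw [Finset.sum_eq_single r]
      · rw [if_pos rfl]
        have h2 : ∑ j, X j * C (aeval y c' * (a j * b r))
            = (∑ j, X j * C (a j)) * (C (aeval y c') * C (b r)) := by
          rw [Finset.sum_mul]
          refine Finset.sum_congr rfl fun j _ => ?_
          rw [C_mul, C_mul, mul_assoc, mul_left_comm (C (a j))]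
        rw [h2, ← add_mul, neg_add_cancel, zero_mul]
      · intro r' _ hr'
        rw [if_neg (Ne.symm hr')]
        simp
      · simp

/-! ### Specialisation and Gauss's lemma -/

/-- If a ring homomorphism `A[X] → S[X]` sends `X` to a nonzero multiple of `X` and kills `q`, then
the image of the trailing coefficient of `q` vanishes at `0`: the power of `X` dividing `q` may be
cancelled before specialising to `0`. -/
theorem eval_zero_trailingCoeff {A S : Type*} [CommRing A] [CommRing S] [IsDomain S]
    (Ψ : Polynomial A →+* Polynomial S) {u : S} (hu : u ≠ 0)
    (hX : Ψ Polynomial.X = Polynomial.C u * Polynomial.X) {q : Polynomial A} (hq : Ψ q = 0) :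
    (Ψ (Polynomial.C q.trailingCoeff)).eval 0 = 0 := by
  obtain ⟨q', hq'⟩ : Polynomial.X ^ q.natTrailingDegree ∣ q :=
    Polynomial.X_pow_dvd_iff.2 fun e he => Polynomial.coeff_eq_zero_of_lt_natTrailingDegree he
  have h0 : q.trailingCoeff = q'.coeff 0 := by
    have h1 := Polynomial.coeff_X_pow_mul q' q.natTrailingDegree 0
    rw [← hq', zero_add] at h1
    exact h1
  have h2 : Ψ q' = 0 := by
    rw [hq', map_mul, map_pow, hX] at hq
    refine (mul_eq_zero.1 hq).resolve_left (pow_ne_zero _ (mul_ne_zero ?_ Polynomial.X_ne_zero))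
    simpa using hu
  rw [← Polynomial.divX_mul_X_add q', map_add, map_mul, hX, ← h0] at h2
  have h3 := congrArg (Polynomial.eval 0) h2
  simpa using h3

/-- Algebraic independence may be tested after specialising the parameters: if polynomials `v i` in
parameters become algebraically independent at one value `z` of the parameters, then they are
algebraically independent over the ring of parameters. -/
theorem aeval_eq_zero_of_specialization {K S ι σ : Type*} [CommRing K] [IsDomain K] [Infinite K]
    [CommRing S] [IsDomain S] [Algebra K S] (v : ι → MvPolynomial σ S) (z : σ → K)
    (hz : ∀ g : MvPolynomial ι K, aeval (fun i => eval (fun j => algebraMap K S (z j)) (v i)) g = 0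
      → g = 0)
    (p : MvPolynomial (ι ⊕ σ) K) (hp : aeval (Sum.elim v X) p = 0) : p = 0 := by
  by_contra hp0
  obtain ⟨w, hw⟩ : ∃ w, eval w p ≠ 0 := by
    by_contra! h
    exact hp0 (MvPolynomial.funext fun x => by rw [h x, map_zero])
  -- restrict the parameters to the line from `z` to the point `w` where `p` does not vanish
  let line : MvPolynomial (ι ⊕ σ) K →ₐ[K] Polynomial (MvPolynomial ι K) :=
    aeval (Sum.elim (fun i => Polynomial.C (X i)) fun j =>
      Polynomial.C (C (z j)) + Polynomial.X * Polynomial.C (C (w (Sum.inr j) - z j)))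
  let lineS : MvPolynomial σ S →ₐ[S] Polynomial S :=
    aeval fun j => Polynomial.C (algebraMap K S (z j)) +
      Polynomial.X * Polynomial.C (algebraMap K S (w (Sum.inr j) - z j))
  let Ψ : Polynomial (MvPolynomial ι K) →+* Polynomial S :=
    Polynomial.eval₂RingHom (aeval fun i => lineS (v i)).toRingHom Polynomial.X
  have hline : line p ≠ 0 := by
    intro h
    have h1 : ((eval fun i => w (Sum.inl i)).comp
        ((Polynomial.evalRingHom (1 : MvPolynomial ι K)).comp line.toRingHom)) p = 0 := by
      simp [h]
    refine hw ?_
    rw [← h1]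
    congr 1
    refine MvPolynomial.ringHom_ext (fun r => ?_) fun i => ?_
    · simp [line, MvPolynomial.algebraMap_eq]
    · cases i <;> simp [line]
  have hΨ : Ψ (line p) = 0 := by
    have h1 : Ψ (line p) = lineS (aeval (Sum.elim v X) p) := by
      have h2 : Ψ.comp line.toRingHom
          = lineS.toRingHom.comp (aeval (R := K) (Sum.elim v X)).toRingHom := by
        refine MvPolynomial.ringHom_ext (fun r => ?_) fun i => ?_
        · simp [line, Ψ, MvPolynomial.algebraMap_eq, lineS, MvPolynomial.algebraMap_apply,
            Polynomial.algebraMap_apply]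
        · cases i <;> simp [line, Ψ, lineS, Polynomial.algebraMap_apply]
      exact congrArg (fun f => f p) h2
    rw [h1, hp, map_zero]
  have h0 := eval_zero_trailingCoeff Ψ one_ne_zero (by simp [Ψ]) hΨ
  refine hline (Polynomial.trailingCoeff_eq_zero.1 (hz _ ?_))
  rw [← h0]
  have h2 : (aeval (R := K) fun i => eval (fun j => algebraMap K S (z j)) (v i)).toRingHom
      = (Polynomial.evalRingHom (0 : S)).comp (Ψ.comp Polynomial.C) := by
    refine MvPolynomial.ringHom_ext (fun r => ?_) fun i => ?_
    · simp [Ψ, Polynomial.algebraMap_apply]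
    · have h3 : (Polynomial.evalRingHom (0 : S)).comp lineS.toRingHom
          = eval fun j => algebraMap K S (z j) := by
        refine MvPolynomial.ringHom_ext (fun r => ?_) fun j => ?_
        · simp [lineS]
        · simp [lineS]
      simpa [Ψ] using (congrArg (fun f => f (v i)) h3).symm
  exact congrArg (fun f => f (line p).trailingCoeff) h2

/-- Gauss's lemma in the form: a prime ideal of `A[X]` containing no nonzero constant is generated
by any irreducible polynomial in it. -/
theorem dvd_of_map_eq_zero {A T : Type*} [CommRing A] [IsDomain A] [UniqueFactorizationMonoid A]
    [CommRing T] [IsDomain T] (φ : Polynomial A →+* T) (hφ : ∀ a, φ (Polynomial.C a) = 0 → a = 0)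
    {P Q : Polynomial A} (hP : Irreducible P) (hP0 : φ P = 0) (hQ0 : φ Q = 0) : P ∣ Q := by
  classical
  let _ : NormalizedGCDMonoid A := Classical.choice inferInstance
  have hdeg : P.natDegree ≠ 0 := by
    intro h
    rw [Polynomial.eq_C_of_natDegree_eq_zero h] at hP0 hP
    rw [hφ _ hP0, map_zero] at hP
    exact hP.ne_zero rfl
  have hprim : P.IsPrimitive := hP.isPrimitive hdeg
  rw [hprim.dvd_iff_fraction_map_dvd_fraction_map (FractionRing A)]
  have hirr := (hprim.irreducible_iff_irreducible_map_fraction_map (K := FractionRing A)).1 hP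
  by_contra hnd
  have hinj : Function.Injective ((algebraMap T (FractionRing T)).comp (φ.comp Polynomial.C)) := by
    rw [injective_iff_map_eq_zero]
    intro a ha
    refine hφ a ?_
    simpa using ha
  let Φ : Polynomial (FractionRing A) →+* FractionRing T :=
    Polynomial.eval₂RingHom (IsFractionRing.lift hinj)
      (algebraMap T (FractionRing T) (φ Polynomial.X))
  have hΦ : ∀ R : Polynomial A, Φ (R.map (algebraMap A (FractionRing A)))
      = algebraMap T (FractionRing T) (φ R) := by
    intro R
    have : Φ.comp (Polynomial.mapRingHom (algebraMap A (FractionRing A)))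
        = (algebraMap T (FractionRing T)).comp φ := by
      refine Polynomial.ringHom_ext (fun a => ?_) ?_
      · simp [Φ]
      · simp [Φ]
    exact congrArg (fun f => f R) this
  obtain ⟨a, b, hab⟩ := hirr.coprime_iff_not_dvd.2 hnd
  have h1 := congrArg Φ hab
  rw [map_add, map_mul, map_mul, hΦ, hΦ, hP0, hQ0] at h1
  simp at h1

/-! ### Degrees in the rows of a matrix of variables -/

section

section RowDegree

variable {B I O : Type*} [CommRing B] [DecidableEq I]

/-- The substitution multiplying the variables of row `i` by a new variable; its degree in the new
variable is the degree in the variables of row `i`. -/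
noncomputable def rowScale (B : Type*) {I : Type*} (O : Type*) [CommRing B] [DecidableEq I]
    (i : I) : MvPolynomial (I × O) B →ₐ[B] Polynomial (MvPolynomial (I × O) B) :=
  aeval fun v => if v.1 = i then Polynomial.C (X v) * Polynomial.X else Polynomial.C (X v)

theorem eval_one_rowScale (i : I) (p : MvPolynomial (I × O) B) :
    (rowScale B O i p).eval 1 = p := by
  have : (Polynomial.evalRingHom (1 : MvPolynomial (I × O) B)).comp (rowScale B O i).toRingHom
      = RingHom.id _ := by
    refine MvPolynomial.ringHom_ext (fun r => ?_) fun v => ?_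
    · simp [rowScale, Polynomial.algebraMap_apply]
    · by_cases h : v.1 = i <;> simp [rowScale, h]
  exact congrArg (fun f => f p) this

theorem rowScale_ne_zero (i : I) {p : MvPolynomial (I × O) B} (hp : p ≠ 0) :
    rowScale B O i p ≠ 0 := by
  intro h
  apply hp
  rw [← eval_one_rowScale i p, h, Polynomial.eval_zero]

variable [Fintype I] [Fintype O]

theorem rowScale_monomial (i : I) (m : I × O →₀ ℕ) (c : B) :
    rowScale B O i (monomial m c) =
      Polynomial.C (monomial m c) * Polynomial.X ^ (∑ o, m (i, o)) := by
  rw [rowScale, aeval_monomial, Finsupp.prod_fintype _ _ (by simp), monomial_eq,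
    Finsupp.prod_fintype _ _ (by simp)]
  have h1 : ∀ v : I × O,
      (if v.1 = i then Polynomial.C (X v) * Polynomial.X else Polynomial.C (X v) :
      Polynomial (MvPolynomial (I × O) B)) ^ m v
      = Polynomial.C (X v) ^ m v * (if v.1 = i then Polynomial.X ^ m v else 1) := by
    intro v
    split_ifs
    · rw [mul_pow]
    · rw [mul_one]
  have h2 : ∏ v : I × O, (if v.1 = i then Polynomial.X ^ m v else 1 :
      Polynomial (MvPolynomial (I × O) B)) = Polynomial.X ^ (∑ o, m (i, o)) := by
    rw [Fintype.prod_prod_type, Finset.prod_eq_single i]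
    · simp [Finset.prod_pow_eq_pow_sum]
    · intro i' _ hi'
      simp [hi']
    · simp
  have h3 : ∏ v : I × O, (Polynomial.C (X v) : Polynomial (MvPolynomial (I × O) B)) ^ m v
      = Polynomial.C (∏ v, X v ^ m v) := by
    rw [map_prod]
    simp only [Polynomial.C_pow]
  rw [Finset.prod_congr rfl fun v _ => h1 v, Finset.prod_mul_distrib, h2, h3, Polynomial.C_mul,
    mul_assoc]
  rfl

theorem sum_row_le_natDegree (i : I) (p : MvPolynomial (I × O) B) {m : I × O →₀ ℕ}
    (hm : m ∈ p.support) : ∑ o, m (i, o) ≤ (rowScale B O i p).natDegree := by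
  classical
  refine Polynomial.le_natDegree_of_ne_zero fun h0 => mem_support_iff.1 hm ?_
  have h1 : (rowScale B O i p).coeff (∑ o, m (i, o))
      = ∑ m' ∈ p.support,
        if ∑ o, m (i, o) = ∑ o, m' (i, o) then monomial m' (coeff m' p) else 0 := by
    conv_lhs => rw [p.as_sum, map_sum, Polynomial.finsetSum_coeff]
    refine Finset.sum_congr rfl fun m' _ => ?_
    rw [rowScale_monomial, Polynomial.coeff_C_mul, Polynomial.coeff_X_pow]
    simp
  have h2 := congrArg (coeff m) (h1.symm.trans h0)
  rw [coeff_sum, coeff_zero, Finset.sum_eq_single m] at h2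
  · simpa using h2
  · intro m' _ hm'
    split_ifs
    · rw [coeff_monomial, if_neg hm']
    · rw [coeff_zero]
  · intro h
    exact absurd hm h

theorem totalDegree_le_sum_rowScale (p : MvPolynomial (I × O) B) :
    p.totalDegree ≤ ∑ i, (rowScale B O i p).natDegree := by
  rw [totalDegree]
  refine Finset.sup_le fun m hm => ?_
  rw [Finsupp.sum_fintype _ _ (by simp), Fintype.sum_prod_type]
  exact Finset.sum_le_sum fun i _ => sum_row_le_natDegree i p hm

end RowDegree

/-- General combinations `-∑ j, λ_{ρ l, j} g_j`, one for each of `s` rows of indeterminate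
coefficients, are algebraically independent if each power `x_l ^ d` is among the `g_j`: at suitable
values of the coefficients they become the powers `x_l ^ d`. -/
theorem aeval_combination_eq_zero {B I J : Type*} [CommRing B] [IsDomain B] [Infinite B] [Fintype J]
    {s d : ℕ} (hd : 1 ≤ d) (g : J → MvPolynomial (Fin s) B) (pure : Fin s → J)
    (hpure : ∀ l, g (pure l) = X l ^ d) (ρ : Fin s → I) (hρ : Function.Injective ρ)
    (p : MvPolynomial (Fin s) (MvPolynomial (I × J) B))
    (hp : aeval (fun l => -∑ j,
      C (X (ρ l, j)) * map (C : B →+* MvPolynomial (I × J) B) (g j)) p = 0) :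
    p = 0 := by
  classical
  let v : Fin s → MvPolynomial (I × J) (MvPolynomial (Fin s) B) :=
    fun l => -∑ j, X (ρ l, j) * C (g j)
  let swap : MvPolynomial (Fin s) (MvPolynomial (I × J) B) →+*
      MvPolynomial (I × J) (MvPolynomial (Fin s) B) :=
    eval₂Hom (map (C : B →+* MvPolynomial (Fin s) B)) fun l => C (X l)
  have hswap : ∀ q : MvPolynomial (Fin s) B,
      swap (map (C : B →+* MvPolynomial (I × J) B) q) = C q := by
    intro q
    have : swap.comp (map (C : B →+* MvPolynomial (I × J) B)) = C := by
      refine MvPolynomial.ringHom_ext (fun r => ?_) fun l => ?_ <;> simp [swap]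
    exact congrArg (fun f => f q) this
  have hswapX : ∀ c, swap (C (X c)) = X c := fun c => by simp [swap]
  obtain ⟨p', rfl⟩ := (sumAlgEquiv B (Fin s) (I × J)).surjective p
  have hp' : aeval (Sum.elim v X) p' = 0 := by
    have h1 : (aeval (R := B) (Sum.elim v X)).toRingHom = swap.comp ((aeval (fun l => -∑ j,
        C (X (ρ l, j)) * map (C : B →+* MvPolynomial (I × J) B) (g j))).toRingHom.comp
        (sumAlgEquiv B (Fin s) (I × J)).toAlgHom.toRingHom) := by
      refine MvPolynomial.ringHom_ext (fun r => ?_) fun i => ?_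
      · simp [swap, MvPolynomial.algebraMap_apply]
      · cases i with
        | inl l =>
          change aeval (Sum.elim v X) (X (Sum.inl l)) = swap (aeval _ (sumAlgEquiv B (Fin s) (I × J)
            (X (Sum.inl l))))
          rw [sumAlgEquiv_X_inl, aeval_X, aeval_X, map_neg, map_sum]
          simp only [map_mul, hswap, hswapX]
          rfl
        | inr c => simp [swap, MvPolynomial.algebraMap_eq]
    have h2 := congrArg (fun f => f p') h1
    refine h2.trans ?_
    change swap (aeval _ (sumAlgEquiv B (Fin s) (I × J) p')) = 0
    rw [hp, map_zero]
  rw [aeval_eq_zero_of_specialization v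
    (fun ij => if ∃ l, ρ l = ij.1 ∧ pure l = ij.2 then -1 else 0) ?_ p' hp', map_zero]
  intro q hq
  refine (expand_eq_zero (p := d) hd).1 ?_
  rw [← hq]
  have : (fun l => eval (fun ij : I × J => algebraMap B (MvPolynomial (Fin s) B)
      (if ∃ l, ρ l = ij.1 ∧ pure l = ij.2 then -1 else 0)) (v l)) = fun l => X l ^ d := by
    funext l
    simp only [v, map_neg, map_sum, map_mul, eval_X, eval_C]
    rw [Finset.sum_eq_single (pure l)]
    · rw [if_pos ⟨l, rfl, rfl⟩, hpure]
      simp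
    · intro j _ hj
      rw [if_neg, map_zero, zero_mul]
      rintro ⟨l', h1, h2⟩
      rw [hρ h1] at h2
      exact hj h2.symm
    · simp
  rw [this]
  rfl

end

/-! ### The Chow form -/

section

section Chow

variable {B J : Type*} [CommRing B] [Fintype J] {s d : ℕ}

/-- The generic point of the incidence variety of the `s + 1` combinations
`t_i + ∑ j, λ_{i j} g_j = 0`: the variables `(i, some j)` stand for `λ_{i j}`, the variable
`(i, none)` stands for `t_i` and is replaced by `-∑ j, λ_{i j} g_j`. -/
noncomputable def chowSubst (g : J → MvPolynomial (Fin s) B) :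
    MvPolynomial (Fin (s + 1) × Option J) B →ₐ[B]
      MvPolynomial (Fin s) (MvPolynomial (Fin (s + 1) × J) B) :=
  aeval fun v => v.2.elim (-∑ j, C (X (v.1, j)) * map C (g j)) fun j => C (X (v.1, j))

theorem chowSubst_none (g : J → MvPolynomial (Fin s) B) (i : Fin (s + 1)) :
    chowSubst g (X (i, none)) = -∑ j, C (X (i, j)) * map C (g j) := by
  simp [chowSubst]

theorem chowSubst_some (g : J → MvPolynomial (Fin s) B) (i : Fin (s + 1)) (j : J) :
    chowSubst g (X (i, some j)) = C (X (i, j)) := by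
  simp [chowSubst]

variable [IsDomain B] [Infinite B]

/-- The kernel of `chowSubst` is principal. -/
theorem dvd_of_chowSubst_eq_zero [UniqueFactorizationMonoid B] (hd : 1 ≤ d)
    (g : J → MvPolynomial (Fin s) B) (pure : Fin s → J) (hpure : ∀ l, g (pure l) = X l ^ d)
    {P Q : MvPolynomial (Fin (s + 1) × Option J) B} (hP : Irreducible P)
    (hP0 : chowSubst g P = 0) (hQ0 : chowSubst g Q = 0) : P ∣ Q := by
  -- single out the variable `(0, none)`
  let κ : Polynomial (MvPolynomial (Fin s) (MvPolynomial (Fin (s + 1) × J) B)) →+*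
      MvPolynomial (Fin (s + 1) × Option J) B :=
    Polynomial.eval₂RingHom
      (eval₂Hom (eval₂Hom C fun ij => X (ij.1, some ij.2)) fun l => X (l.succ, none)) (X (0, none))
  let κ' : MvPolynomial (Fin (s + 1) × Option J) B →+*
      Polynomial (MvPolynomial (Fin s) (MvPolynomial (Fin (s + 1) × J) B)) :=
    eval₂Hom (Polynomial.C.comp (C.comp C)) fun v =>
      v.2.elim (Fin.cases Polynomial.X (fun l => Polynomial.C (X l)) v.1)
        fun j => Polynomial.C (C (X (v.1, j)))
  have h1 : κ.comp κ' = RingHom.id _ := by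
    refine MvPolynomial.ringHom_ext (fun r => ?_) fun v => ?_
    · simp [κ, κ']
    · obtain ⟨i, o⟩ := v
      cases o with
      | none => refine Fin.cases ?_ (fun l => ?_) i <;> simp [κ, κ']
      | some j => simp [κ, κ']
  have h2 : κ'.comp κ = RingHom.id _ := by
    refine Polynomial.ringHom_ext' (MvPolynomial.ringHom_ext' (MvPolynomial.ringHom_ext'
      (RingHom.ext fun r => ?_) fun ij => ?_) fun l => ?_) ?_ <;> simp [κ, κ']
  let e : Polynomial (MvPolynomial (Fin s) (MvPolynomial (Fin (s + 1) × J) B)) ≃+*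
      MvPolynomial (Fin (s + 1) × Option J) B := RingEquiv.ofRingHom κ κ' h1 h2
  have he : ∀ R, e (e.symm R) = R := e.apply_symm_apply
  have hfree : ∀ a : MvPolynomial (Fin s) (MvPolynomial (Fin (s + 1) × J) B),
      (chowSubst g).toRingHom.comp κ (Polynomial.C a) = 0 → a = 0 := by
    intro a ha
    refine aeval_combination_eq_zero hd g pure hpure Fin.succ (Fin.succ_injective _) a ?_
    rw [← ha]
    have : (aeval (R := MvPolynomial (Fin (s + 1) × J) B) fun l : Fin s =>
        -∑ j, C (X (l.succ, j)) * map (C : B →+* MvPolynomial (Fin (s + 1) × J) B) (g j)).toRingHom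
        = ((chowSubst g).toRingHom.comp κ).comp Polynomial.C := by
      refine MvPolynomial.ringHom_ext' (MvPolynomial.ringHom_ext'
        (RingHom.ext fun r => ?_) fun ij => ?_) fun l => ?_
      · simp [κ, MvPolynomial.algebraMap_eq, MvPolynomial.algebraMap_apply]
      · simp [κ, chowSubst_some, MvPolynomial.algebraMap_eq]
      · simp [κ, chowSubst_none]
    exact congrArg (fun f => f a) this
  have hdvd : e.symm P ∣ e.symm Q := by
    refine dvd_of_map_eq_zero ((chowSubst g).toRingHom.comp κ) hfree
      ((MulEquiv.irreducible_iff e.symm).2 hP) ?_ ?_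
    · change chowSubst g (e (e.symm P)) = 0
      rw [he, hP0]
    · change chowSubst g (e (e.symm Q)) = 0
      rw [he, hQ0]
  simpa [he] using map_dvd e hdvd

/-- For each row `i` the kernel of `chowSubst` contains an element of degree at most `d ^ s` in the
variables of that row: the norm of the `i`-th combination, taken over the subalgebra generated by
the other ones. -/
theorem exists_chowSubst_eq_zero_of_row (hd : 1 ≤ d) (g : J → MvPolynomial (Fin s) B)
    (hg : ∀ j, (g j).totalDegree ≤ d) (pure : Fin s → J) (hpure : ∀ l, g (pure l) = X l ^ d)
    (i : Fin (s + 1)) :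
    ∃ Q : MvPolynomial (Fin (s + 1) × Option J) B, Q ≠ 0 ∧ chowSubst g Q = 0 ∧
      (rowScale B (Option J) i Q).natDegree ≤ d ^ s := by
  let y : Fin s → MvPolynomial (Fin s) (MvPolynomial (Fin s × J) B) :=
    fun l => -∑ j, C (X (l, j)) * map C (g j)
  have hy : ∀ l, (y l).totalDegree ≤ d := by
    intro l
    rw [totalDegree_neg]
    refine totalDegree_finsetSum_le fun j _ => (totalDegree_mul _ _).trans ?_
    rw [totalDegree_C, zero_add]
    exact (Finset.sup_mono (support_map_subset _ _)).trans (hg j)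
  obtain ⟨Q, hQ0, hQd, hQ⟩ := exists_norm hy
    (fun p hp => aeval_combination_eq_zero hd g pure hpure id Function.injective_id p hp)
    fun j => map C (g j)
  -- rename the variables: `i` is the distinguished row, `i.succAbove l` the other ones
  let lam : MvPolynomial (Fin s × J) B →+* MvPolynomial (Fin (s + 1) × Option J) B :=
    eval₂Hom C fun lj => X (i.succAbove lj.1, some lj.2)
  let coef : MvPolynomial (Fin s) (MvPolynomial (Fin s × J) B) →+*
      MvPolynomial (Fin (s + 1) × Option J) B :=
    eval₂Hom lam fun l => X (i.succAbove l, none)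
  let ren : MvPolynomial (Option J) (MvPolynomial (Fin s) (MvPolynomial (Fin s × J) B)) →+*
      MvPolynomial (Fin (s + 1) × Option J) B := eval₂Hom coef fun o => X (i, o)
  let back : MvPolynomial (Fin (s + 1) × Option J) B →+*
      MvPolynomial (Option J) (MvPolynomial (Fin s) (MvPolynomial (Fin s × J) B)) :=
    eval₂Hom (C.comp (C.comp C)) fun v =>
      i.insertNth (α := fun _ => Option J →
        MvPolynomial (Option J) (MvPolynomial (Fin s) (MvPolynomial (Fin s × J) B))) X
        (fun l o => o.elim (C (X l)) fun j => C (C (X (l, j)))) v.1 v.2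
  have hback : back.comp ren = RingHom.id _ := by
    refine MvPolynomial.ringHom_ext' (MvPolynomial.ringHom_ext' (MvPolynomial.ringHom_ext'
      (RingHom.ext fun r => ?_) fun lj => ?_) fun l => ?_) fun o => ?_ <;>
      simp [back, ren, coef, lam]
  refine ⟨ren Q, fun h => hQ0 ?_, ?_, ?_⟩
  · have h1 : back (ren Q) = Q := congrArg (fun f => f Q) hback
    rw [← h1, h, map_zero]
  · -- the substitution of `exists_norm` followed by the inclusion of its target
    let inc : MvPolynomial (Fin s) (MvPolynomial (Fin s × J) B) →+*
        MvPolynomial (Fin s) (MvPolynomial (Fin (s + 1) × J) B) :=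
      map (rename fun lj : Fin s × J => (i.succAbove lj.1, lj.2)).toRingHom
    let incJ : MvPolynomial J (MvPolynomial (Fin s) (MvPolynomial (Fin s × J) B)) →+*
        MvPolynomial (Fin s) (MvPolynomial (Fin (s + 1) × J) B) :=
      eval₂Hom inc fun j => C (X (i, j))
    have hinc : ∀ q : MvPolynomial (Fin s) B, inc (map C q) = map C q := by
      intro q
      have : inc.comp (map C) = map C := by
        refine MvPolynomial.ringHom_ext (fun r => ?_) fun l => ?_ <;> simp [inc]
      exact congrArg (fun f => f q) this
    have h1 : (chowSubst g).toRingHom.comp ren = incJ.comp (eval₂Hom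
        ((C : MvPolynomial (Fin s) (MvPolynomial (Fin s × J) B) →+*
          MvPolynomial J (MvPolynomial (Fin s) (MvPolynomial (Fin s × J) B))).comp
          (aeval (R := MvPolynomial (Fin s × J) B) y).toRingHom)
        (fun o : Option J => o.elim (-∑ j, X j * C (map C (g j))) X)) := by
      refine MvPolynomial.ringHom_ext' (MvPolynomial.ringHom_ext' (MvPolynomial.ringHom_ext'
        (RingHom.ext fun r => ?_) fun lj => ?_) fun l => ?_) fun o => ?_
      · simp [ren, coef, lam, incJ, inc, MvPolynomial.algebraMap_eq, MvPolynomial.algebraMap_apply]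
      · simp [ren, coef, lam, incJ, inc, chowSubst_some, MvPolynomial.algebraMap_eq]
      · have h2 : incJ (C (y l)) = -∑ j, C (X (i.succAbove l, j)) * map C (g j) := by
          have h3 : incJ (C (y l)) = inc (y l) := by simp [incJ]
          rw [h3]
          simp only [y, map_neg, map_sum, map_mul, hinc]
          simp [inc]
        simpa [ren, coef, chowSubst_none] using h2.symm
      · cases o with
        | none =>
          have h2 : incJ (-∑ j, X j * C (map C (g j))) = -∑ j, C (X (i, j)) * map C (g j) := by
            simp only [map_neg, map_sum, map_mul]
            simp only [incJ, coe_eval₂Hom, eval₂_X, eval₂_C, hinc]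
          simpa [ren, chowSubst_none] using h2.symm
        | some j => simp [ren, incJ, chowSubst_some]
    have h2 := congrArg (fun f => f Q) h1
    refine h2.trans ?_
    rw [RingHom.comp_apply, hQ, map_zero]
  · have h1 : ∀ q, ((rowScale B (Option J) i) (coef q)) = Polynomial.C (coef q) := by
      intro q
      have : (rowScale B (Option J) i).toRingHom.comp coef = Polynomial.C.comp coef := by
        refine MvPolynomial.ringHom_ext' (MvPolynomial.ringHom_ext'
          (RingHom.ext fun r => ?_) fun lj => ?_) fun l => ?_
        · simp [coef, lam, rowScale, Polynomial.algebraMap_apply, MvPolynomial.algebraMap_eq]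
        · simp [coef, lam, rowScale, Fin.succAbove_ne]
        · simp [coef, rowScale, Fin.succAbove_ne]
      exact congrArg (fun f => f q) this
    have h2 : rowScale B (Option J) i (ren Q) = ∑ m ∈ Q.support, Polynomial.C (coef (coeff m Q)) *
        ∏ o, (Polynomial.C (X (i, o)) * Polynomial.X) ^ m o := by
      simp only [ren, coe_eval₂Hom, eval₂_eq', map_sum, map_mul, map_prod, map_pow, h1]
      simp [rowScale]
    rw [h2]
    refine (Polynomial.natDegree_sum_le_of_forall_le _ _ fun m hm => ?_).trans hQd
    refine (Polynomial.natDegree_C_mul_le _ _).trans ?_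
    refine (Polynomial.natDegree_prod_le _ _).trans ?_
    have h3 : ∑ o, m o ≤ Q.totalDegree := by
      have := le_totalDegree hm
      rwa [Finsupp.sum_fintype _ _ (by simp)] at this
    refine le_trans (Finset.sum_le_sum fun o _ => ?_) h3
    refine Polynomial.natDegree_pow_le.trans ?_
    refine (Nat.mul_le_mul_left _
      ((Polynomial.natDegree_C_mul_le _ _).trans Polynomial.natDegree_X_le)).trans ?_
    rw [mul_one]

/-- The Chow form: a nonzero polynomial of degree at most `(s + 1) * d ^ s` in the coefficients of
`s + 1` combinations of polynomials of degree at most `d` in `s` variables, among them the powers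
`x_l ^ d`, which vanishes whenever the combinations have a common zero. -/
theorem exists_chowForm [UniqueFactorizationMonoid B] (hd : 1 ≤ d) (g : J → MvPolynomial (Fin s) B)
    (hg : ∀ j, (g j).totalDegree ≤ d) (pure : Fin s → J) (hpure : ∀ l, g (pure l) = X l ^ d) :
    ∃ P : MvPolynomial (Fin (s + 1) × Option J) B, P ≠ 0 ∧ P.totalDegree ≤ (s + 1) * d ^ s ∧
      chowSubst g P = 0 := by
  have hprime : (RingHom.ker (chowSubst g)).IsPrime := RingHom.ker_isPrime _
  choose Q hQ0 hQ hQd using exists_chowSubst_eq_zero_of_row hd g hg pure hpure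
  obtain ⟨P, hPker, hP⟩ := hprime.exists_mem_prime_of_ne_bot
    fun h => hQ0 0 ((Submodule.mem_bot _).1 (h ▸ RingHom.mem_ker.2 (hQ 0)))
  refine ⟨P, hP.ne_zero, (totalDegree_le_sum_rowScale P).trans ?_, hPker⟩
  refine (Finset.sum_le_card_nsmul _ _ (d ^ s) fun i _ => ?_).trans (by simp)
  obtain ⟨R, hR⟩ := dvd_of_chowSubst_eq_zero hd g pure hpure hP.irreducible hPker (hQ i)
  have h1 : R ≠ 0 := fun h => hQ0 i (by rw [hR, h, mul_zero])
  have h2 := hQd i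
  rw [hR, map_mul, Polynomial.natDegree_mul (rowScale_ne_zero i hP.ne_zero)
    (rowScale_ne_zero i h1)] at h2
  omega

end Chow

end

/-! ### The obstruction -/

section

theorem totalDegree_aeval_le {σ τ K B : Type*} [Fintype σ] [CommRing K] [CommRing B] [Algebra K B]
    (F : MvPolynomial σ K) (v : σ → MvPolynomial τ B) (hv : ∀ i, (v i).totalDegree ≤ 1) :
    (aeval v F).totalDegree ≤ F.totalDegree := by
  rw [aeval_def, eval₂_eq']
  refine totalDegree_finsetSum_le fun m hm => ?_
  refine (totalDegree_mul _ _).trans ?_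
  rw [MvPolynomial.algebraMap_apply, totalDegree_C, zero_add]
  refine (totalDegree_finsetProd _ _).trans ?_
  refine le_trans (Finset.sum_le_sum fun i _ => ?_)
    ((Finsupp.sum_fintype m (fun _ e => e) fun _ => rfl).symm.trans_le (le_totalDegree hm))
  refine (totalDegree_pow _ _).trans ?_
  exact (Nat.mul_le_mul_left _ (hv i)).trans (mul_one _).le

section CoeffDegree

variable {σ B : Type*} [CommRing B]

theorem totalDegree_coeff_mul_le {p q : Polynomial (MvPolynomial σ B)} {a b : ℕ}
    (hp : ∀ e, (p.coeff e).totalDegree ≤ a) (hq : ∀ e, (q.coeff e).totalDegree ≤ b) (e : ℕ) :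
    ((p * q).coeff e).totalDegree ≤ a + b := by
  rw [Polynomial.coeff_mul]
  exact totalDegree_finsetSum_le fun x _ =>
    (totalDegree_mul _ _).trans (add_le_add (hp _) (hq _))

theorem totalDegree_coeff_pow_le {p : Polynomial (MvPolynomial σ B)}
    (hp : ∀ e, (p.coeff e).totalDegree ≤ 1) (n : ℕ) :
    ∀ e, ((p ^ n).coeff e).totalDegree ≤ n := by
  induction n with
  | zero =>
    intro e
    rw [pow_zero, Polynomial.coeff_one]
    split_ifs <;> simp
  | succ n ih =>
    rw [pow_succ]
    exact totalDegree_coeff_mul_le ih hp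

theorem totalDegree_coeff_prod_le {ι : Type*} (t : Finset ι) {p : ι → Polynomial (MvPolynomial σ B)}
    {a : ι → ℕ} (hp : ∀ i ∈ t, ∀ e, ((p i).coeff e).totalDegree ≤ a i) :
    ∀ e, ((∏ i ∈ t, p i).coeff e).totalDegree ≤ ∑ i ∈ t, a i := by
  classical
  induction t using Finset.induction_on with
  | empty =>
    intro e
    rw [Finset.prod_empty, Polynomial.coeff_one]
    split_ifs <;> simp
  | insert i t hi ih =>
    rw [Finset.prod_insert hi, Finset.sum_insert hi]
    exact totalDegree_coeff_mul_le (hp i (Finset.mem_insert_self _ _))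
      (ih fun i' hi' => hp i' (Finset.mem_insert_of_mem hi'))

theorem totalDegree_coeff_aeval_le {τ : Type*} [Fintype τ] (F : MvPolynomial τ B)
    (v : τ → Polynomial (MvPolynomial σ B)) (hv : ∀ i e, ((v i).coeff e).totalDegree ≤ 1) (e : ℕ) :
    ((aeval v F).coeff e).totalDegree ≤ F.totalDegree := by
  rw [aeval_def, eval₂_eq', Polynomial.finsetSum_coeff]
  refine totalDegree_finsetSum_le fun m hm => ?_
  rw [Polynomial.algebraMap_apply, algebraMap_eq, Polynomial.coeff_C_mul]
  refine (totalDegree_mul _ _).trans ?_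
  rw [totalDegree_C, zero_add]
  exact (totalDegree_coeff_prod_le _ (fun i _ => totalDegree_coeff_pow_le (hv i) (m i)) e).trans
    ((Finsupp.sum_fintype m (fun _ e => e) fun _ => rfl).symm.trans_le (le_totalDegree hm))

end CoeffDegree

/-- A polynomial `P` of degree at most `(s + 1) * d ^ s` in the entries of `Λ`, with coefficients
polynomial in the entries of a matrix `M`, which vanishes if the linear space parametrised by `M`
contains a point `y` at which the `s + 1` combinations `∑ j, Λ i j • f j` vanish although not all
`f j` do.

The Chow form is applied to the restrictions of the `f j` to the linear space together with the
powers of the coordinates of that space. These powers only make the combinations independent; they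
are given coefficients proportional to a parameter, and `P` is the term of lowest order in the
parameter. -/
theorem exists_obstruction {n m d : ℕ} (s : ℕ) (hd : 1 ≤ d)
    (f : Fin m → MvPolynomial (Fin (n + 1)) ℂ) (hf : ∀ j, (f j).totalDegree ≤ d) :
    ∃ P : MvPolynomial (Fin (s + 1) × Fin m) (MvPolynomial (Fin (n + 1) × Fin (s + 1)) ℂ),
      P ≠ 0 ∧ P.totalDegree ≤ (s + 1) * d ^ s ∧
      ∀ (E : Type) [CommRing E] [IsDomain E] [Algebra ℂ E] (M : Fin (n + 1) × Fin (s + 1) → E)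
        (ξ : Fin s → E) (y : Fin (n + 1) → E)
        (_ : ∀ l, y l = M (l, 0) + ∑ i : Fin s, M (l, i.succ) * ξ i)
        (Λ : Matrix (Fin (s + 1)) (Fin m) ℂ),
        (∃ j, aeval y (f j) ≠ 0) →
        (∀ i, ∑ j, algebraMap ℂ E (Λ i j) * aeval y (f j) = 0) →
        eval₂ (aeval (R := ℂ) M).toRingHom (fun ij => algebraMap ℂ E (Λ ij.1 ij.2)) P = 0 := by
  let pt : Fin (n + 1) → MvPolynomial (Fin s) (MvPolynomial (Fin (n + 1) × Fin (s + 1)) ℂ) :=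
    fun l => C (X (l, 0)) + ∑ i : Fin s, C (X (l, i.succ)) * X i
  have hpt : ∀ l, (pt l).totalDegree ≤ 1 := by
    intro l
    refine (totalDegree_add _ _).trans (max_le (by simp) (totalDegree_finsetSum_le fun i _ => ?_))
    refine (totalDegree_mul _ _).trans ?_
    rw [totalDegree_C, totalDegree_X]
  let g : Fin s ⊕ Fin m → MvPolynomial (Fin s) (MvPolynomial (Fin (n + 1) × Fin (s + 1)) ℂ) :=
    Sum.elim (fun l => X l ^ d) fun j => aeval pt (f j)
  have hg : ∀ j, (g j).totalDegree ≤ d := by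
    rintro (l | j)
    · exact (totalDegree_X_pow _ _).le
    · exact (totalDegree_aeval_le _ _ hpt).trans (hf j)
  obtain ⟨P₀, hP₀, hP₀d, hP₀v⟩ := exists_chowForm hd g hg Sum.inl fun _ => rfl
  obtain ⟨M₀, c, hc⟩ : ∃ M₀ c, eval c (map (eval M₀) P₀) ≠ 0 := by
    by_contra! h
    refine hP₀ (MvPolynomial.ext _ _ fun a => MvPolynomial.funext fun M₀ => ?_)
    have h1 : map (eval M₀) P₀ = 0 := MvPolynomial.funext fun c => by rw [h M₀ c, map_zero]
    have h2 := congrArg (coeff a) h1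
    rw [coeff_map, coeff_zero] at h2
    rw [h2, coeff_zero, map_zero]
  -- the constant terms and the coefficients of the powers `X l ^ d` become multiples of a parameter
  let val : Fin (s + 1) × Option (Fin s ⊕ Fin m) →
      Polynomial (MvPolynomial (Fin (s + 1) × Fin m)
        (MvPolynomial (Fin (n + 1) × Fin (s + 1)) ℂ)) :=
    fun v => v.2.elim (Polynomial.C (C (C (c v))) * Polynomial.X)
      (Sum.elim (fun _ => Polynomial.C (C (C (c v))) * Polynomial.X)
        fun j => Polynomial.C (X (v.1, j)))
  have hval : ∀ v e, ((val v).coeff e).totalDegree ≤ 1 := by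
    have h1 : ∀ (r : ℂ) e, ((Polynomial.C (C (C r) : MvPolynomial (Fin (s + 1) × Fin m)
        (MvPolynomial (Fin (n + 1) × Fin (s + 1)) ℂ)) * Polynomial.X).coeff e).totalDegree ≤ 1 := by
      intro r e
      rw [Polynomial.coeff_C_mul_X]
      split_ifs <;> simp
    rintro ⟨i, (_ | (l | j))⟩ e
    · exact h1 _ e
    · exact h1 _ e
    · change ((Polynomial.C (X (i, j))).coeff e).totalDegree ≤ 1
      rw [Polynomial.coeff_C]
      split_ifs <;> simp
  set q := aeval (R := MvPolynomial (Fin (n + 1) × Fin (s + 1)) ℂ) val P₀ with hq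
  have hq0 : q ≠ 0 := by
    intro h
    apply hc
    have h1 : (eval c).comp (map (eval M₀)) =
        (eval₂Hom (eval M₀) fun ij => c (ij.1, some (.inr ij.2))).comp
        ((Polynomial.evalRingHom 1).comp
          (aeval (R := MvPolynomial (Fin (n + 1) × Fin (s + 1)) ℂ) val).toRingHom) := by
      refine MvPolynomial.ringHom_ext (fun r => ?_) ?_
      · simp [Polynomial.algebraMap_apply, algebraMap_eq]
      · rintro ⟨i, (_ | (l | j))⟩ <;> simp [val]
    have h2 := congrArg (fun f => f P₀) h1
    refine h2.trans ?_
    change (eval₂Hom _ _) (Polynomial.eval 1 q) = 0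
    rw [h, Polynomial.eval_zero, map_zero]
  refine ⟨q.trailingCoeff, fun h => hq0 (Polynomial.trailingCoeff_eq_zero.1 h),
    (totalDegree_coeff_aeval_le _ _ hval _).trans hP₀d, ?_⟩
  intro E _ _ _ M ξ y hy Λ hne hzero
  obtain ⟨j₁, hj₁⟩ := hne
  set φ : Fin m → E := fun j => aeval y (f j) with hφ
  let r : Fin (s + 1) → E := fun i => algebraMap ℂ E (c (i, none)) +
    ∑ l, algebraMap ℂ E (c (i, some (.inl l))) * ξ l ^ d
  -- move `Λ` in the column `j₁` to keep the perturbed combinations zero at `y`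
  let lam : Fin (s + 1) × Fin m → Polynomial E := fun ij =>
    Polynomial.C (algebraMap ℂ E (Λ ij.1 ij.2)) -
      if ij.2 = j₁ then Polynomial.C (r ij.1) * Polynomial.X else 0
  let big : Fin (s + 1) × Option (Fin s ⊕ Fin m) → Polynomial E := fun v =>
    v.2.elim (Polynomial.C (φ j₁ * algebraMap ℂ E (c v)) * Polynomial.X)
      (Sum.elim (fun _ => Polynomial.C (φ j₁ * algebraMap ℂ E (c v)) * Polynomial.X)
        fun j => lam (v.1, j))
  let base : MvPolynomial (Fin (n + 1) × Fin (s + 1)) ℂ →+* Polynomial E :=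
    Polynomial.C.comp (aeval (R := ℂ) M).toRingHom
  let ev : MvPolynomial (Fin s) (MvPolynomial (Fin (s + 1) × (Fin s ⊕ Fin m))
      (MvPolynomial (Fin (n + 1) × Fin (s + 1)) ℂ)) →+* Polynomial E :=
    eval₂Hom (eval₂Hom base fun ij => big (ij.1, some ij.2)) fun l => Polynomial.C (ξ l)
  have hevg : ∀ j, ev (map C (g (.inr j))) = Polynomial.C (φ j) := by
    intro j
    have : (ev.comp (map C)).comp (aeval (R := ℂ) pt).toRingHom
        = Polynomial.C.comp (aeval (R := ℂ) y).toRingHom := by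
      refine MvPolynomial.ringHom_ext (fun a => ?_) fun l => ?_
      · simp [ev, base, MvPolynomial.algebraMap_apply]
      · simp [ev, base, pt, hy]
    exact congrArg (fun h => h (f j)) this
  have hchow : ev.comp (chowSubst g).toRingHom = eval₂Hom base big := by
    refine MvPolynomial.ringHom_ext (fun a => ?_) ?_
    · simp [ev, chowSubst, MvPolynomial.algebraMap_apply]
    · rintro ⟨i, (_ | j)⟩
      · have h1 : ∀ j, ev (C (X (i, j))) = big (i, some j) := fun j => by simp [ev]
        have h2 : ∀ l, ev (map C (g (.inl l))) = Polynomial.C (ξ l) ^ d := fun l => by simp [ev, g]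
        change ev (chowSubst g (X (i, none))) = _
        rw [chowSubst_none, map_neg, map_sum, Fintype.sum_sum_type, eval₂Hom_X']
        simp only [map_mul, h1, h2, hevg, big, lam, Option.elim_some, Option.elim_none,
          Sum.elim_inl, Sum.elim_inr, sub_mul, Finset.sum_sub_distrib, ite_mul, zero_mul,
          Finset.sum_ite_eq',
          Finset.mem_univ, if_true]
        have h3 : ∑ j, Polynomial.C (algebraMap ℂ E (Λ i j)) * Polynomial.C (φ j) = 0 := by
          simp only [← Polynomial.C_mul, ← map_sum]
          rw [hzero i, map_zero]
        have h4 : Polynomial.C (r i) = Polynomial.C (algebraMap ℂ E (c (i, none))) +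
            ∑ l, Polynomial.C (algebraMap ℂ E (c (i, some (.inl l)))) * Polynomial.C (ξ l) ^ d := by
          simp [r, map_sum]
        have h5 : ∑ l, Polynomial.C (φ j₁) * Polynomial.C (algebraMap ℂ E (c (i, some (.inl l)))) *
              Polynomial.X * Polynomial.C (ξ l) ^ d
            = Polynomial.C (φ j₁) * Polynomial.X * ∑ l, Polynomial.C (algebraMap ℂ E
              (c (i, some (.inl l)))) * Polynomial.C (ξ l) ^ d := by
          rw [Finset.mul_sum]
          exact Finset.sum_congr rfl fun l _ => by ring
        rw [h3, h4, h5]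
        ring
      · change ev (chowSubst g (X (i, some j))) = _
        rw [chowSubst_some]
        simp [ev]
  let Ψ : Polynomial (MvPolynomial (Fin (s + 1) × Fin m)
      (MvPolynomial (Fin (n + 1) × Fin (s + 1)) ℂ)) →+* Polynomial E :=
    Polynomial.eval₂RingHom (eval₂Hom base lam) (Polynomial.C (φ j₁) * Polynomial.X)
  have hΨ : Ψ.comp (aeval (R := MvPolynomial (Fin (n + 1) × Fin (s + 1)) ℂ) val).toRingHom
      = eval₂Hom base big := by
    refine MvPolynomial.ringHom_ext (fun a => ?_) ?_
    · simp [Ψ, Polynomial.algebraMap_apply, algebraMap_eq]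
    · rintro ⟨i, (_ | (l | j))⟩
      · simp [Ψ, val, big, base]
        ring
      · simp [Ψ, val, big, base]
        ring
      · simp [Ψ, val, big]
  have hΨq : Ψ q = 0 := by
    have h1 : Ψ q = eval₂Hom base big P₀ := congrArg (fun h => h P₀) hΨ
    have h2 : ev (chowSubst g P₀) = eval₂Hom base big P₀ := congrArg (fun h => h P₀) hchow
    rw [h1, ← h2, hP₀v, map_zero]
  have h0 := eval_zero_trailingCoeff Ψ hj₁ (Polynomial.eval₂_X _ _) hΨq
  have h1 : (Polynomial.evalRingHom (0 : E)).comp (Ψ.comp Polynomial.C)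
      = eval₂Hom (aeval (R := ℂ) M).toRingHom fun ij => algebraMap ℂ E (Λ ij.1 ij.2) := by
    refine MvPolynomial.ringHom_ext (fun a => ?_) fun ij => ?_
    · have h2 : Ψ (Polynomial.C (C a)) = Polynomial.C (aeval M a) :=
        (Polynomial.eval₂_C _ _).trans (eval₂Hom_C _ _ _)
      rw [RingHom.comp_apply, RingHom.comp_apply, h2, eval₂Hom_C]
      exact Polynomial.eval_C
    · by_cases h : ij.2 = j₁ <;> simp [Ψ, lam, h]
  have h2 := congrArg (fun h => h q.trailingCoeff) h1
  exact h2.symm.trans h0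

end

/-! ### Cones and their ideals -/

section

attribute [local instance] MvPolynomial.gradedAlgebra

variable {n : ℕ}

/-- The affine cone over `Y ⊆ ℙⁿ`, the origin included. -/
def cone (Y : Set (PSpace n)) : Set (Fin (n + 1) → ℂ) :=
  {v | ∀ hv : v ≠ 0, Projectivization.mk ℂ v hv ∈ Y}

/-- The ideal of the polynomials vanishing on the affine cone over `Y`. -/
noncomputable def coneIdeal (Y : Set (PSpace n)) : Ideal (MvPolynomial (Fin (n + 1)) ℂ) :=
  vanishingIdeal ℂ (cone Y)

theorem mem_coneIdeal {Y : Set (PSpace n)} {F : MvPolynomial (Fin (n + 1)) ℂ} :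
    F ∈ coneIdeal Y ↔ ∀ v ∈ cone Y, eval v F = 0 :=
  Iff.rfl

theorem zero_mem_cone (Y : Set (PSpace n)) : (0 : Fin (n + 1) → ℂ) ∈ cone Y :=
  fun h => absurd rfl h

theorem rep_mem_cone {Y : Set (PSpace n)} {p : PSpace n} (hp : p ∈ Y) : p.rep ∈ cone Y := by
  intro h
  rwa [Projectivization.mk_rep]

theorem smul_mem_cone {Y : Set (PSpace n)} {v : Fin (n + 1) → ℂ} (hv : v ∈ cone Y) (c : ℂ) :
    c • v ∈ cone Y := by
  intro hcv
  have hv0 : v ≠ 0 := fun h => hcv (by rw [h, smul_zero])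
  have hc0 : c ≠ 0 := fun h => hcv (by rw [h, zero_smul])
  have : Projectivization.mk ℂ (c • v) hcv = Projectivization.mk ℂ v hv0 :=
    (Projectivization.mk_eq_mk_iff' ℂ _ _ _ _).2 ⟨c, rfl⟩
  rw [this]
  exact hv hv0

theorem mk_mem_zeroLocus {S : Set (MvPolynomial (Fin (n + 1)) ℂ)}
    (hS : ∀ F ∈ S, ∃ e : ℕ, F.IsHomogeneous e) {v : Fin (n + 1) → ℂ} (hv : v ≠ 0) :
    Projectivization.mk ℂ v hv ∈ zeroLocus S ↔ ∀ F ∈ S, eval v F = 0 := by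
  refine forall₂_congr fun F hF => ?_
  obtain ⟨e, he⟩ := hS F hF
  exact eval_rep_eq_zero_iff he v hv

theorem eval_smul_of_isHomogeneous {σ : Type*} {F : MvPolynomial σ ℂ} {e : ℕ}
    (hF : F.IsHomogeneous e) (c : ℂ) (v : σ → ℂ) : eval (c • v) F = c ^ e * eval v F := by
  rw [eval_eq, eval_eq, Finset.mul_sum]
  refine Finset.sum_congr rfl fun m hm => ?_
  have hdeg : ∑ i ∈ m.support, m i = e := by
    have := hF (mem_support_iff.mp hm)
    simpa [Finsupp.weight_apply, Finsupp.sum] using this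
  simp only [Pi.smul_apply, smul_eq_mul, mul_pow, Finset.prod_mul_distrib,
    Finset.prod_pow_eq_pow_sum, hdeg]
  ring

/-- The restriction of `F` to the line through `v`, as a polynomial: its coefficients are the values
at `v` of the homogeneous components of `F`. -/
theorem exists_polynomial_eval_smul {σ : Type*} (F : MvPolynomial σ ℂ) (v : σ → ℂ) :
    ∃ q : Polynomial ℂ, (∀ c, q.eval c = eval (c • v) F) ∧
      ∀ e, q.coeff e = eval v (homogeneousComponent e F) := by
  refine ⟨∑ e ∈ Finset.range (F.totalDegree + 1),
    Polynomial.C (eval v (homogeneousComponent e F)) * Polynomial.X ^ e, fun c => ?_, fun e => ?_⟩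
  · conv_rhs => rw [← sum_homogeneousComponent F]
    rw [Polynomial.eval_finsetSum, map_sum]
    refine Finset.sum_congr rfl fun e _ => ?_
    rw [eval_smul_of_isHomogeneous (homogeneousComponent_isHomogeneous e F)]
    rw [Polynomial.eval_mul, Polynomial.eval_C, Polynomial.eval_pow, Polynomial.eval_X, mul_comm]
  · rw [Polynomial.finsetSum_coeff]
    simp only [Polynomial.coeff_C_mul, Polynomial.coeff_X_pow, mul_ite, mul_one, mul_zero,
      Finset.sum_ite_eq, Finset.mem_range]
    split_ifs with h
    · rfl
    · rw [homogeneousComponent_eq_zero _ _ (by omega), map_zero]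

theorem homogeneousComponent_mem_coneIdeal {Y : Set (PSpace n)}
    {F : MvPolynomial (Fin (n + 1)) ℂ} (hF : F ∈ coneIdeal Y) (e : ℕ) :
    homogeneousComponent e F ∈ coneIdeal Y := by
  rw [mem_coneIdeal] at hF ⊢
  intro v hv
  obtain ⟨q, hq, hqc⟩ := exists_polynomial_eval_smul F v
  have : q = 0 := Polynomial.funext fun c => by
    rw [hq, hF _ (smul_mem_cone hv c), Polynomial.eval_zero]
  rw [← hqc, this, Polynomial.coeff_zero]

/-- For nonempty `Y` the vertex of the cone need not be tested. -/
theorem mem_coneIdeal_of_forall_ne_zero {Y : Set (PSpace n)} (hY : Y.Nonempty)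
    {F : MvPolynomial (Fin (n + 1)) ℂ} (hF : ∀ v ∈ cone Y, v ≠ 0 → eval v F = 0) :
    F ∈ coneIdeal Y := by
  rw [mem_coneIdeal]
  intro v hv
  by_cases hv0 : v = 0
  · obtain ⟨p, hp⟩ := hY
    obtain ⟨q, hq, -⟩ := exists_polynomial_eval_smul F p.rep
    have : q = 0 := by
      refine Polynomial.eq_zero_of_infinite_isRoot q (Set.Infinite.mono (s := {0}ᶜ) ?_
        (Set.finite_singleton (0 : ℂ)).infinite_compl)
      intro c hc
      change q.eval c = 0
      rw [hq]
      exact hF _ (smul_mem_cone (rep_mem_cone hp) c) (smul_ne_zero hc p.rep_nonzero)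
    have h1 := hq 0
    rw [this, Polynomial.eval_zero, zero_smul] at h1
    rw [hv0, ← h1]
  · exact hF v hv hv0

theorem constantCoeff_eq_zero_of_mem_coneIdeal {Y : Set (PSpace n)}
    {F : MvPolynomial (Fin (n + 1)) ℂ} (hF : F ∈ coneIdeal Y) : eval 0 F = 0 :=
  mem_coneIdeal.1 hF 0 (zero_mem_cone Y)

theorem coneIdeal_isHomogeneous (Y : Set (PSpace n)) :
    (coneIdeal Y).IsHomogeneous (homogeneousSubmodule (Fin (n + 1)) ℂ) := by
  intro e F hF
  have := homogeneousComponent_mem_coneIdeal hF e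
  rwa [← decomposition.decompose'_apply] at this

theorem coneIdeal_isPrime {Y : Set (PSpace n)} (hY : IsIrredVariety Y) : (coneIdeal Y).IsPrime := by
  obtain ⟨⟨S, hS, hYS⟩, hne, hirr⟩ := hY
  refine (coneIdeal_isHomogeneous Y).isPrime_of_homogeneous_mem_or_mem ?_ ?_
  · intro h
    have := constantCoeff_eq_zero_of_mem_coneIdeal ((Ideal.eq_top_iff_one _).1 h)
    simp at this
  · intro F G hF hG hFG
    have hins : ∀ K : MvPolynomial (Fin (n + 1)) ℂ,
        SetLike.IsHomogeneousElem (homogeneousSubmodule (Fin (n + 1)) ℂ) K →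
        ∀ F' ∈ insert K S, ∃ e : ℕ, F'.IsHomogeneous e := by
      rintro K ⟨e, he⟩ F' (rfl | hF')
      · exact ⟨e, he⟩
      · exact hS _ hF'
    have hmem : ∀ K : MvPolynomial (Fin (n + 1)) ℂ,
        SetLike.IsHomogeneousElem (homogeneousSubmodule (Fin (n + 1)) ℂ) K →
        Y = zeroLocus (insert K S) → K ∈ coneIdeal Y := by
      intro K hK hYK
      refine mem_coneIdeal_of_forall_ne_zero hne fun v hv hv0 => ?_
      have h1 := hv hv0
      rw [hYK, mk_mem_zeroLocus (hins K hK)] at h1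
      exact h1 K (Set.mem_insert _ _)
    have hunion : Y = zeroLocus (insert F S) ∪ zeroLocus (insert G S) := by
      apply Set.Subset.antisymm
      · intro p hp
        have h1 := mem_coneIdeal.1 hFG p.rep (rep_mem_cone hp)
        rw [map_mul, mul_eq_zero] at h1
        have h2 : p ∈ zeroLocus S := hYS ▸ hp
        refine h1.imp (fun h => ?_) fun h => ?_
        · rintro F' (rfl | hF')
          exacts [h, h2 _ hF']
        · rintro F' (rfl | hF')
          exacts [h, h2 _ hF']
      · rw [hYS]
        rintro p (hp | hp)
        · exact fun F' hF' => hp F' (Set.mem_insert_of_mem _ hF')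
        · exact fun F' hF' => hp F' (Set.mem_insert_of_mem _ hF')
    exact (hirr _ _ ⟨_, hins F hF, rfl⟩ ⟨_, hins G hG, rfl⟩ hunion).imp (hmem F hF) (hmem G hG)

/-- A variety is determined by the ideal of its cone. -/
theorem mem_of_forall_coneIdeal {Y : Set (PSpace n)} (hY : IsVariety Y) {v : Fin (n + 1) → ℂ}
    (hv : ∀ F ∈ coneIdeal Y, eval v F = 0) : v ∈ cone Y := by
  obtain ⟨S, hS, rfl⟩ := hY
  intro hv0
  rw [mk_mem_zeroLocus hS]
  intro F hF
  by_cases hne : (zeroLocus S).Nonempty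
  · refine hv F (mem_coneIdeal_of_forall_ne_zero hne fun w hw hw0 => ?_)
    exact (mk_mem_zeroLocus hS hw0).1 (hw hw0) F hF
  · rw [Set.not_nonempty_iff_eq_empty] at hne
    have hcone : ∀ w ∈ cone (zeroLocus S), w = 0 := by
      intro w hw
      by_contra hw0
      have := hw hw0
      rw [hne] at this
      exact this
    exfalso
    obtain ⟨l, hl⟩ := Function.ne_iff.1 hv0
    refine hl ?_
    have := hv (X l) (mem_coneIdeal.2 fun w hw => by rw [hcone w hw]; simp)
    simpa using this

/-- The variety defined by the homogeneous elements of an ideal. -/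
def idealVariety (q : Ideal (MvPolynomial (Fin (n + 1)) ℂ)) : Set (PSpace n) :=
  zeroLocus {F | F ∈ q ∧ ∃ e : ℕ, F.IsHomogeneous e}

theorem isVariety_idealVariety (q : Ideal (MvPolynomial (Fin (n + 1)) ℂ)) :
    IsVariety (idealVariety q) :=
  ⟨_, fun _ hF => hF.2, rfl⟩

theorem cone_idealVariety {q : Ideal (MvPolynomial (Fin (n + 1)) ℂ)}
    (hq : q.IsHomogeneous (homogeneousSubmodule (Fin (n + 1)) ℂ)) (hq0 : ∀ F ∈ q, eval 0 F = 0) :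
    cone (idealVariety q) = MvPolynomial.zeroLocus ℂ q := by
  ext v
  change v ∈ cone (idealVariety q) ↔ ∀ F ∈ q, eval v F = 0
  constructor
  · intro hv F hF
    by_cases hv0 : v = 0
    · rw [hv0]
      exact hq0 F hF
    · have h1 := (mk_mem_zeroLocus (fun _ hF => hF.2) hv0).1 (hv hv0)
      have h2 : eval v F = 0 := by
        rw [← sum_homogeneousComponent F, map_sum]
        refine Finset.sum_eq_zero fun e _ => h1 _ ⟨?_, e, homogeneousComponent_isHomogeneous e F⟩
        have := hq e hF
        rwa [← decomposition.decompose'_apply]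
      exact h2
  · intro hv hv0
    exact (mk_mem_zeroLocus (fun _ hF => hF.2) hv0).2 fun F hF => hv F hF.1

theorem coneIdeal_idealVariety {q : Ideal (MvPolynomial (Fin (n + 1)) ℂ)} [q.IsPrime]
    (hq : q.IsHomogeneous (homogeneousSubmodule (Fin (n + 1)) ℂ)) (hq0 : ∀ F ∈ q, eval 0 F = 0) :
    coneIdeal (idealVariety q) = q := by
  rw [coneIdeal, cone_idealVariety hq hq0, IsPrime.vanishingIdeal_zeroLocus]

theorem isIrredVariety_of_isPrime {Z : Set (PSpace n)} (hZ : IsVariety Z) (hne : Z.Nonempty)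
    (hprime : (coneIdeal Z).IsPrime) : IsIrredVariety Z := by
  refine ⟨hZ, hne, fun A B hA hB hAB => ?_⟩
  have hmul : coneIdeal A * coneIdeal B ≤ coneIdeal Z := by
    refine Ideal.mul_le.2 fun F hF G hG => mem_coneIdeal_of_forall_ne_zero hne fun v hv hv0 => ?_
    have h1 := hv hv0
    rw [hAB] at h1
    rw [map_mul, mul_eq_zero]
    refine h1.imp (fun h => mem_coneIdeal.1 hF v fun _ => h)
      fun h => mem_coneIdeal.1 hG v fun _ => h
  have hsub : ∀ A' : Set (PSpace n), IsVariety A' → coneIdeal A' ≤ coneIdeal Z → Z ⊆ A' := by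
    intro A' hA' hle p hp
    have h1 : p.rep ∈ cone A' := mem_of_forall_coneIdeal hA' fun F hF =>
      mem_coneIdeal.1 (hle hF) p.rep (rep_mem_cone hp)
    have h2 := h1 p.rep_nonzero
    rwa [Projectivization.mk_rep] at h2
  refine (hprime.mul_le.1 hmul).imp (fun h => ?_) fun h => ?_
  · exact (hsub A hA h).antisymm (hAB ▸ Set.subset_union_left)
  · exact (hsub B hB h).antisymm (hAB ▸ Set.subset_union_right)

/-- Irreducible components correspond to minimal primes. -/
theorem coneIdeal_mem_minimalPrimes {Y : Set (PSpace n)} {S : Set (MvPolynomial (Fin (n + 1)) ℂ)}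
    (hS : ∀ F ∈ S, ∃ e : ℕ, F.IsHomogeneous e) (hY : IsComponent Y (zeroLocus S)) :
    coneIdeal Y ∈ (Ideal.span S).minimalPrimes := by
  obtain ⟨⟨hirr, hYS⟩, hmax⟩ := hY
  have hprime := coneIdeal_isPrime hirr
  refine ⟨⟨hprime, Ideal.span_le.2 fun F hF => ?_⟩, ?_⟩
  · refine mem_coneIdeal_of_forall_ne_zero hirr.2.1 fun v hv hv0 => ?_
    exact (mk_mem_zeroLocus hS hv0).1 (hYS (hv hv0)) F hF
  · rintro q ⟨hq, hSq⟩ hqY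
    -- the homogeneous core of `q` is a homogeneous prime ideal between `S` and `q`
    let q' := (q.homogeneousCore (homogeneousSubmodule (Fin (n + 1)) ℂ)).toIdeal
    have hq' : q'.IsPrime := hq.homogeneousCore
    have hq'h : q'.IsHomogeneous (homogeneousSubmodule (Fin (n + 1)) ℂ) :=
      HomogeneousIdeal.isHomogeneous _
    have hq'q : q' ≤ q := Ideal.toIdeal_homogeneousCore_le _ _
    have hq'0 : ∀ F ∈ q', eval 0 F = 0 := fun F hF =>
      constantCoeff_eq_zero_of_mem_coneIdeal (hqY (hq'q hF))
    have hSq' : ∀ F ∈ S, F ∈ q' := by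
      intro F hF
      obtain ⟨e, he⟩ := hS F hF
      exact Ideal.mem_homogeneousCore_of_homogeneous_of_mem ⟨e, he⟩ (hSq (Ideal.subset_span hF))
    have hYZ : Y ⊆ idealVariety q' := by
      intro p hp F hF
      exact mem_coneIdeal.1 (hqY (hq'q hF.1)) p.rep (rep_mem_cone hp)
    have hZ : IsIrredVariety (idealVariety q') := by
      refine isIrredVariety_of_isPrime (isVariety_idealVariety q') (hirr.2.1.mono hYZ) ?_
      rw [coneIdeal_idealVariety hq'h hq'0]
      exact hq'
    have hZS : idealVariety q' ⊆ zeroLocus S := fun p hp F hF => hp F ⟨hSq' F hF, hS F hF⟩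
    have hYeq : Y = idealVariety q' := hYZ.antisymm (hmax ⟨hZ, hZS⟩ hYZ)
    calc coneIdeal Y = coneIdeal (idealVariety q') := by rw [← hYeq]
      _ = q' := coneIdeal_idealVariety hq'h hq'0
      _ ≤ q := hq'q

end

/-! ### Linear forms without common zeros on a variety -/

section

variable {n c : ℕ}

/-- The linear forms given by the rows of `u` have no common zero on `Y`. -/
def Avoids (Y : Set (PSpace n)) (u : Matrix (Fin c) (Fin (n + 1)) ℂ) : Prop :=
  ∀ v ∈ cone Y, u.mulVec v = 0 → v = 0

theorem avoids_iff_not_meets {Y : Set (PSpace n)} {u : Matrix (Fin c) (Fin (n + 1)) ℂ} :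
    Avoids Y u ↔ ¬ Meets Y (LinearMap.ker u.mulVecLin) := by
  constructor
  · rintro hu ⟨p, hp, hpu⟩
    refine p.rep_nonzero (hu p.rep (rep_mem_cone hp) ?_)
    rw [Projectivization.submodule_eq, Submodule.span_singleton_le_iff_mem] at hpu
    exact hpu
  · intro h v hv huv
    by_contra hv0
    refine h ⟨Projectivization.mk ℂ v hv0, hv hv0, ?_⟩
    rw [Projectivization.submodule_mk, Submodule.span_singleton_le_iff_mem]
    exact huv

/-- The linear form given by the row `i` of `u`. -/
noncomputable def linForm (u : Matrix (Fin c) (Fin (n + 1)) ℂ) (i : Fin c) :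
    MvPolynomial (Fin (n + 1)) ℂ :=
  ∑ l, C (u i l) * X l

theorem eval_linForm (u : Matrix (Fin c) (Fin (n + 1)) ℂ) (i : Fin c) (v : Fin (n + 1) → ℂ) :
    eval v (linForm u i) = u.mulVec v i := by
  simp [linForm, Matrix.mulVec, dotProduct]

theorem linForm_isHomogeneous (u : Matrix (Fin c) (Fin (n + 1)) ℂ) (i : Fin c) :
    (linForm u i).IsHomogeneous 1 :=
  IsHomogeneous.sum _ _ _ fun l _ => by
    simpa using (isHomogeneous_C (Fin (n + 1)) (u i l)).mul (isHomogeneous_X ℂ l)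

theorem eval_aeval_linForm (u : Matrix (Fin c) (Fin (n + 1)) ℂ) (W : MvPolynomial (Fin c) ℂ)
    (v : Fin (n + 1) → ℂ) : eval v (aeval (linForm u) W) = eval (u.mulVec v) W := by
  have : (eval v).comp (aeval (R := ℂ) (linForm u)).toRingHom = eval (u.mulVec v) := by
    refine MvPolynomial.ringHom_ext (fun r => ?_) fun i => ?_
    · simp
    · simp [eval_linForm]
  exact congrArg (fun f => f W) this

/-- If `c` linear forms avoid `Y` and no fewer do, then they are algebraically independent on the
cone over `Y`: from a relation, projecting from a point where it does not vanish gives `c - 1`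
linear forms avoiding `Y`. -/
theorem eq_zero_of_aeval_linForm_mem {Y : Set (PSpace n)} {u : Matrix (Fin c) (Fin (n + 1)) ℂ}
    (hu : Avoids Y u)
    (hmin : ∀ c' < c, ∀ u' : Matrix (Fin c') (Fin (n + 1)) ℂ, ¬ Avoids Y u')
    (W : MvPolynomial (Fin c) ℂ) (hW : aeval (linForm u) W ∈ coneIdeal Y) : W = 0 := by
  by_contra hW0
  obtain ⟨e, he⟩ : ∃ e, homogeneousComponent e W ≠ 0 := by
    by_contra! h
    exact hW0 (by rw [← sum_homogeneousComponent W, Finset.sum_eq_zero fun e _ => h e])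
  have hhom := homogeneousComponent_isHomogeneous e W
  obtain ⟨z, hz⟩ : ∃ z, eval z (homogeneousComponent e W) ≠ 0 := by
    by_contra! h
    exact he (MvPolynomial.funext fun z => by rw [h z, map_zero])
  have hvan : ∀ v ∈ cone Y, eval (u.mulVec v) (homogeneousComponent e W) = 0 := by
    intro v hv
    obtain ⟨q, hq, hqc⟩ := exists_polynomial_eval_smul W (u.mulVec v)
    have : q = 0 := Polynomial.funext fun t => by
      rw [hq, ← Matrix.mulVec_smul, ← eval_aeval_linForm, Polynomial.eval_zero]
      exact mem_coneIdeal.1 hW _ (smul_mem_cone hv t)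
    rw [← hqc, this, Polynomial.coeff_zero]
  have he0 : e ≠ 0 := by
    rintro rfl
    have h1 := hvan 0 (zero_mem_cone Y)
    rw [Matrix.mulVec_zero] at h1
    have h2 := eval_smul_of_isHomogeneous hhom 0 z
    rw [zero_smul, pow_zero, one_mul, h1] at h2
    exact hz h2.symm
  have hz0 : z ≠ 0 := by
    rintro rfl
    have h2 := eval_smul_of_isHomogeneous hhom 0 0
    rw [zero_smul, zero_pow he0, zero_mul] at h2
    exact hz h2
  obtain ⟨i₀, hi₀⟩ := Function.ne_iff.1 hz0
  rw [Pi.zero_apply] at hi₀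
  obtain ⟨c, rfl⟩ : ∃ c', c = c' + 1 := ⟨c - 1, by have := i₀.pos; omega⟩
  -- project from `z`
  refine hmin c (Nat.lt_succ_self c) (Matrix.of fun j l =>
    u (i₀.succAbove j) l - z (i₀.succAbove j) / z i₀ * u i₀ l) fun v hv hv' => hu v hv ?_
  have hrow : ∀ j : Fin c,
      u.mulVec v (i₀.succAbove j) = u.mulVec v i₀ / z i₀ * z (i₀.succAbove j) := by
    intro j
    have h1 := congrFun hv' j
    simp only [Matrix.mulVec, dotProduct, Matrix.of_apply, sub_mul, Finset.sum_sub_distrib,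
      Pi.zero_apply, mul_assoc, ← Finset.mul_sum] at h1
    rw [sub_eq_zero] at h1
    simp only [Matrix.mulVec, dotProduct]
    rw [h1]
    ring
  have huv : u.mulVec v = (u.mulVec v i₀ / z i₀) • z := by
    funext i
    refine Fin.succAboveCases i₀ ?_ (fun j => ?_) i
    · rw [Pi.smul_apply, smul_eq_mul, div_mul_cancel₀ _ hi₀]
    · rw [hrow j, Pi.smul_apply, smul_eq_mul]
  have h3 := hvan v hv
  rw [huv, eval_smul_of_isHomogeneous hhom, mul_eq_zero] at h3
  have h4 : u.mulVec v i₀ / z i₀ = 0 := (pow_eq_zero_iff he0).1 (h3.resolve_right hz)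
  rw [huv, h4, zero_smul]

theorem homogeneousComponent_succ_mul {σ : Type*} {L : MvPolynomial σ ℂ} (hL : L.IsHomogeneous 1)
    (N : ℕ) (h : MvPolynomial σ ℂ) :
    homogeneousComponent (N + 1) (L * h) = L * homogeneousComponent N h := by
  conv_lhs => rw [← sum_homogeneousComponent h, Finset.mul_sum, map_sum]
  have h1 : ∀ e, homogeneousComponent (N + 1) (L * homogeneousComponent e h)
      = if e = N then L * homogeneousComponent N h else 0 := by
    intro e
    have h2 : (L * homogeneousComponent e h).IsHomogeneous (1 + e) :=
      hL.mul (homogeneousComponent_isHomogeneous e h)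
    rw [homogeneousComponent_of_mem ((mem_homogeneousSubmodule _ _).2 h2)]
    by_cases h3 : e = N
    · rw [if_pos h3, if_pos (by omega), h3]
    · rw [if_neg h3, if_neg (by omega)]
  rw [Finset.sum_congr rfl fun e _ => h1 e, Finset.sum_ite_eq']
  split_ifs with h3
  · rfl
  · rw [homogeneousComponent_eq_zero _ _ (by simpa using h3), mul_zero]

/-- The Nullstellensatz for linear forms avoiding `Y`: modulo the ideal of the cone, every monomial
of large degree is a combination of the linear forms. -/
theorem exists_monomial_sub_mem {Y : Set (PSpace n)} (hY : IsVariety Y)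
    {u : Matrix (Fin c) (Fin (n + 1)) ℂ} (hu : Avoids Y u) :
    ∃ N : ℕ, ∀ a : Fin (n + 1) →₀ ℕ, a.degree = N + 1 →
      ∃ h : Fin c → MvPolynomial (Fin (n + 1)) ℂ, (∀ i, (h i).IsHomogeneous N) ∧
        monomial a 1 - ∑ i, linForm u i * h i ∈ coneIdeal Y := by
  have hrad : idealOfVars (Fin (n + 1)) ℂ ≤
      (coneIdeal Y ⊔ Ideal.span (Set.range (linForm u))).radical := by
    rw [← vanishingIdeal_zeroLocus_eq_radical (K := ℂ), idealOfVars, Ideal.span_le]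
    rintro _ ⟨l, rfl⟩ v hv
    have hv1 : v ∈ cone Y := mem_of_forall_coneIdeal hY fun F hF =>
      hv F (Ideal.mem_sup_left hF)
    have hv2 : u.mulVec v = 0 := by
      funext i
      rw [← eval_linForm]
      exact hv _ (Ideal.mem_sup_right (Ideal.subset_span ⟨i, rfl⟩))
    rw [hu v hv1 hv2]
    simp
  obtain ⟨N, hN⟩ := Ideal.exists_pow_le_of_le_radical_of_fg hrad (idealOfVars_fg _ _)
  refine ⟨N, fun a ha => ?_⟩
  have h1 : monomial a (1 : ℂ) ∈ idealOfVars (Fin (n + 1)) ℂ ^ N :=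
    (monomial_mem_pow_idealOfVars_iff N a one_ne_zero).2 (by omega)
  obtain ⟨q, hq, z, hz, hqz⟩ := Submodule.mem_sup.1 (hN h1)
  obtain ⟨h, hh⟩ := (Ideal.mem_span_range_iff_exists_fun).1 hz
  refine ⟨fun i => homogeneousComponent N (h i),
    fun i => homogeneousComponent_isHomogeneous N _, ?_⟩
  have h2 : homogeneousComponent (N + 1) (monomial a (1 : ℂ)) = monomial a 1 := by
    rw [homogeneousComponent_of_mem
      ((mem_homogeneousSubmodule _ _).2 (isHomogeneous_monomial 1 ha)), if_pos rfl]
  have h3 : monomial a (1 : ℂ) - ∑ i, linForm u i * homogeneousComponent N (h i)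
      = homogeneousComponent (N + 1) q := by
    rw [← h2, ← hqz, ← hh, map_add, map_sum, add_sub_assoc, ← Finset.sum_sub_distrib,
      Finset.sum_eq_zero, add_zero]
    intro i _
    rw [mul_comm (h i), homogeneousComponent_succ_mul (linForm_isHomogeneous u i), sub_self]
  rw [h3]
  exact homogeneousComponent_mem_coneIdeal hq _

theorem Avoids.exists_of_le {Y : Set (PSpace n)} {u : Matrix (Fin c) (Fin (n + 1)) ℂ}
    (hu : Avoids Y u) {c' : ℕ} (hc : c ≤ c') :
    ∃ u' : Matrix (Fin c') (Fin (n + 1)) ℂ, Avoids Y u' := by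
  refine ⟨Matrix.of fun i l => if h : i.1 < c then u ⟨i.1, h⟩ l else 0, fun v hv huv => hu v hv ?_⟩
  funext i
  have h1 := congrFun huv (Fin.castLE hc i)
  simpa [Matrix.mulVec, dotProduct] using h1

/-- If some `c` linear forms avoid `Y`, then generic ones do: write every monomial of large degree
as a combination of the given forms modulo the ideal of the cone. When the forms are varied with
the coefficients of the combinations fixed, the monomials remain solutions of a linear system at
the common zeros; its determinant is the polynomial sought. -/
theorem exists_generic_avoids {Y : Set (PSpace n)} (hY : IsVariety Y)
    {u₀ : Matrix (Fin c) (Fin (n + 1)) ℂ} (hu₀ : Avoids Y u₀) :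
    ∃ Q : MvPolynomial (Fin c × Fin (n + 1)) ℂ, Q ≠ 0 ∧
      ∀ u : Matrix (Fin c) (Fin (n + 1)) ℂ, eval (fun ij => u ij.1 ij.2) Q ≠ 0 → Avoids Y u := by
  classical
  obtain ⟨N, hN⟩ := exists_monomial_sub_mem hY hu₀
  obtain ⟨S, hS⟩ : ∃ S : Finset (Fin (n + 1) →₀ ℕ),
      S = Finset.finsuppAntidiag Finset.univ (N + 1) := ⟨_, rfl⟩
  have hI : ∀ a : S, a.1.degree = N + 1 := fun a => by
    rw [Finsupp.degree_eq_sum]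
    exact (Finset.mem_finsuppAntidiag.1 (hS ▸ a.2)).1
  choose h hh hmem using fun a : S => hN a.1 (hI a)
  let q : S → MvPolynomial (Fin (n + 1)) ℂ := fun a => monomial a.1 1 - ∑ i, linForm u₀ i * h a i
  -- the row `a` of `T` at `u` holds the coefficients of `q a + ∑ i, linForm u i * h a i`
  let T : Matrix S S (MvPolynomial (Fin c × Fin (n + 1)) ℂ) := Matrix.of fun a b =>
    C (coeff b.1 (q a)) + ∑ i, ∑ l, X (i, l) * C (coeff b.1 (X l * h a i))
  have hT : ∀ (u : Matrix (Fin c) (Fin (n + 1)) ℂ) a b,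
      eval (fun ij => u ij.1 ij.2) (T a b) = coeff b.1 (q a + ∑ i, linForm u i * h a i) := by
    intro u a b
    simp only [T, Matrix.of_apply, map_add, map_sum, map_mul, eval_C, eval_X, coeff_add, coeff_sum,
      linForm, Finset.sum_mul, mul_assoc, coeff_C_mul]
  refine ⟨T.det, fun h0 => ?_, fun u hdet v hv huv => ?_⟩
  · have h1 := congrArg (eval fun ij => u₀ ij.1 ij.2) h0
    rw [RingHom.map_det, map_zero] at h1
    have h2 : (eval fun ij : Fin c × Fin (n + 1) => u₀ ij.1 ij.2).mapMatrix T = 1 := by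
      ext1 a b
      rw [RingHom.mapMatrix_apply, Matrix.map_apply, hT]
      simp only [q, sub_add_cancel, coeff_monomial, Matrix.one_apply, Subtype.ext_iff]
    rw [h2, Matrix.det_one] at h1
    exact one_ne_zero h1
  · rw [RingHom.map_det] at hdet
    have h1 : ((eval fun ij : Fin c × Fin (n + 1) => u ij.1 ij.2).mapMatrix T).mulVec
        (fun b : S => ∏ l, v l ^ b.1 l) = 0 := by
      funext a
      have hhom : (q a + ∑ i, linForm u i * h a i).IsHomogeneous (N + 1) := by
        have h3 : ∀ u' : Matrix (Fin c) (Fin (n + 1)) ℂ,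
            (∑ i, linForm u' i * h a i).IsHomogeneous (N + 1) := fun u' =>
          IsHomogeneous.sum _ _ _ fun i _ => by
            rw [add_comm N 1]
            exact (linForm_isHomogeneous u' i).mul (hh a i)
        exact ((isHomogeneous_monomial 1 (hI a)).sub (h3 u₀)).add (h3 u)
      have h4 : eval v (q a + ∑ i, linForm u i * h a i) = 0 := by
        rw [map_add, mem_coneIdeal.1 (hmem a) v hv, map_sum, zero_add]
        refine Finset.sum_eq_zero fun i _ => ?_
        rw [map_mul, eval_linForm, huv, Pi.zero_apply, zero_mul]
      rw [Pi.zero_apply, ← h4, eval_eq', Matrix.mulVec, dotProduct]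
      simp only [RingHom.mapMatrix_apply, Matrix.map_apply, hT]
      have h5 : (q a + ∑ i, linForm u i * h a i).support ⊆
          S := by
        intro b hb
        rw [hS, Finset.mem_finsuppAntidiag]
        refine ⟨?_, Finset.subset_univ _⟩
        have := hhom (mem_support_iff.1 hb)
        rw [← this, Finsupp.weight_apply, Finsupp.sum_fintype _ _ (by simp)]
        simp
      rw [Finset.sum_subset h5 fun b _ hb => by rw [notMem_support_iff.1 hb, zero_mul]]
      exact Finset.sum_coe_sort S fun b => coeff b (q a + ∑ i, linForm u i * h a i) * ∏ l, v l ^ b l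
    have h2 := Matrix.eq_zero_of_mulVec_eq_zero hdet h1
    funext l
    have h3 := congrFun h2 ⟨Finsupp.single l (N + 1), by
      rw [hS, Finset.mem_finsuppAntidiag]
      exact ⟨by rw [← Finsupp.degree_eq_sum, Finsupp.degree_single], Finset.subset_univ _⟩⟩
    simp only [Pi.zero_apply] at h3
    rw [Finset.prod_eq_single l] at h3
    · simpa using h3
    · intro l' _ hl'
      rw [Finsupp.single_eq_of_ne hl', pow_zero]
    · simp

end

/-! ### The lower bound for the dimension -/

section

variable {n c : ℕ}

/-- The ideals of the points of affine space all have the same height, since translations permute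
them; so this height is the dimension. -/
theorem le_height_vanishingIdeal_singleton (w : Fin (n + 1) → ℂ) :
    ((n + 1 : ℕ) : ℕ∞) ≤ (vanishingIdeal ℂ {w} : Ideal (MvPolynomial (Fin (n + 1)) ℂ)).height := by
  have htrans : ∀ w' : Fin (n + 1) → ℂ,
      (vanishingIdeal ℂ {w'} : Ideal (MvPolynomial (Fin (n + 1)) ℂ)).height =
        (vanishingIdeal ℂ {w} : Ideal (MvPolynomial (Fin (n + 1)) ℂ)).height := by
    intro w'
    let φ : (Fin (n + 1) → ℂ) → MvPolynomial (Fin (n + 1)) ℂ →ₐ[ℂ] MvPolynomial (Fin (n + 1)) ℂ :=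
      fun t => aeval fun l => X l + C (t l)
    have hφ : ∀ t, (φ t).comp (φ (-t)) = AlgHom.id ℂ _ := fun t => by
      ext l
      simp [φ, algebraMap_eq]
    have hφ' : ∀ t, (φ (-t)).comp (φ t) = AlgHom.id ℂ _ := fun t => by
      ext l
      simp [φ, algebraMap_eq]
    let e := AlgEquiv.ofAlgHom (φ (w' - w)) (φ (-(w' - w))) (hφ _) (hφ' _)
    rw [← RingEquiv.height_comap e.toRingEquiv (vanishingIdeal ℂ {w})]
    congr 1
    ext F
    rw [Ideal.mem_comap, mem_vanishingIdeal_singleton_iff, mem_vanishingIdeal_singleton_iff]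
    have h1 : (aeval (R := ℂ) w).comp (φ (w' - w)) = aeval w' := by
      ext l
      simp [φ]
    rw [← h1]
    rfl
  have hdim : ringKrullDim (MvPolynomial (Fin (n + 1)) ℂ) ≤
      (vanishingIdeal ℂ {w} : Ideal (MvPolynomial (Fin (n + 1)) ℂ)).height := by
    rw [ringKrullDim_le_iff_isMaximal_height_le]
    intro M hM
    obtain ⟨w', rfl⟩ := isMaximal_iff_eq_vanishingIdeal_singleton.1 hM
    rw [htrans]
  rw [MvPolynomial.ringKrullDim_of_isNoetherianRing, ringKrullDim_eq_zero_of_field, zero_add,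
    Nat.card_fin] at hdim
  exact_mod_cast hdim

theorem exists_le_degree_eq {σ : Type*} (N : ℕ) (a : σ →₀ ℕ) (ha : N ≤ a.degree) :
    ∃ a' ≤ a, a'.degree = N := by
  induction N with
  | zero => exact ⟨0, zero_le, by simp⟩
  | succ N ih =>
    obtain ⟨b, hb, hbN⟩ := ih (by omega)
    obtain ⟨l, hl⟩ : ∃ l, b l < a l := by
      by_contra! h
      rw [le_antisymm hb h] at hbN
      omega
    refine ⟨b + Finsupp.single l 1, fun i => ?_, by rw [map_add, hbN, Finsupp.degree_single]⟩
    by_cases hi : i = l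
    · subst hi
      simpa using hl
    · simpa [Finsupp.single_eq_of_ne hi] using hb i

/-- Cutting the cone over `Y` by translates of linear forms avoiding `Y` leaves finitely many
points. -/
theorem finite_quotient_of_avoids {Y : Set (PSpace n)} (hY : IsVariety Y)
    {u : Matrix (Fin c) (Fin (n + 1)) ℂ} (hu : Avoids Y u) (γ : Fin c → ℂ)
    {Q : Ideal (MvPolynomial (Fin (n + 1)) ℂ)} (hYQ : coneIdeal Y ≤ Q)
    (hγ : ∀ i, linForm u i - C (γ i) ∈ Q) :
    Module.Finite ℂ (MvPolynomial (Fin (n + 1)) ℂ ⧸ Q) := by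
  classical
  obtain ⟨N, hN⟩ := exists_monomial_sub_mem hY hu
  let π : MvPolynomial (Fin (n + 1)) ℂ →ₗ[ℂ] MvPolynomial (Fin (n + 1)) ℂ ⧸ Q :=
    (Ideal.Quotient.mkₐ ℂ Q).toLinearMap
  have hπ : ∀ F G, F - G ∈ Q → π F = π G := fun F G h => Ideal.Quotient.eq.2 h
  let W : Submodule ℂ (MvPolynomial (Fin (n + 1)) ℂ ⧸ Q) :=
    Submodule.span ℂ ((fun b => π (monomial b 1)) '' (degLE (n + 1) N : Set (Fin (n + 1) →₀ ℕ)))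
  have hW : ∀ e, ∀ a : Fin (n + 1) →₀ ℕ, a.degree ≤ e → π (monomial a 1) ∈ W := by
    intro e
    induction e with
    | zero =>
      intro a ha
      exact Submodule.subset_span ⟨a, Finset.mem_coe.2 (mem_degLE.2 (by omega)), rfl⟩
    | succ e ih =>
      intro a ha
      by_cases haN : a.degree ≤ N
      · exact Submodule.subset_span ⟨a, Finset.mem_coe.2 (mem_degLE.2 haN), rfl⟩
      obtain ⟨a', ha'a, ha'⟩ : ∃ a' ≤ a, a'.degree = N + 1 :=
        exists_le_degree_eq (N + 1) a (by omega)
      obtain ⟨h, hh, hmem⟩ := hN a' ha'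
      have h1 : π (monomial a 1) = π (∑ i, C (γ i) * (h i * monomial (a - a') 1)) := by
        apply hπ
        have h2 : monomial a (1 : ℂ) = monomial a' 1 * monomial (a - a') 1 := by
          rw [monomial_mul, one_mul, add_tsub_cancel_of_le ha'a]
        have h3 : monomial a (1 : ℂ) - ∑ i, C (γ i) * (h i * monomial (a - a') 1) =
            (monomial a' 1 - ∑ i, linForm u i * h i) * monomial (a - a') 1 +
              ∑ i, (linForm u i - C (γ i)) * (h i * monomial (a - a') 1) := by
          simp only [h2, sub_mul, Finset.sum_sub_distrib, Finset.sum_mul, mul_assoc]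
          ring
        rw [h3]
        exact Q.add_mem (Q.mul_mem_right _ (hYQ hmem))
          (Q.sum_mem fun i _ => Q.mul_mem_right _ (hγ i))
      rw [h1, map_sum]
      refine W.sum_mem fun i _ => ?_
      rw [← smul_eq_C_mul, map_smul]
      refine W.smul_mem _ ?_
      rw [(h i).as_sum, Finset.sum_mul, map_sum]
      refine W.sum_mem fun b hb => ?_
      have hbN : b.degree = N := by
        have := hh i (mem_support_iff.1 hb)
        rw [← this, Finsupp.weight_apply, Finsupp.sum_fintype _ _ (by simp), Finsupp.degree_eq_sum]
        simp
      have h4 : monomial b (coeff b (h i)) * monomial (a - a') (1 : ℂ)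
          = coeff b (h i) • monomial (b + (a - a')) 1 := by
        rw [monomial_mul, smul_monomial, smul_eq_mul]
      rw [h4, map_smul]
      refine W.smul_mem _ (ih _ ?_)
      have h5 : a.degree = a'.degree + (a - a').degree := by
        rw [← map_add, add_tsub_cancel_of_le ha'a]
      rw [map_add]
      omega
  refine ⟨⟨(degLE (n + 1) N).image fun b => π (monomial b 1), ?_⟩⟩
  rw [Finset.coe_image, eq_top_iff]
  rintro x -
  obtain ⟨F, rfl⟩ := Ideal.Quotient.mk_surjective x
  change π F ∈ W
  rw [F.as_sum, map_sum]
  refine W.sum_mem fun b _ => ?_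
  have : monomial b (coeff b F) = coeff b F • monomial b (1 : ℂ) := by
    rw [smul_monomial, smul_eq_mul, mul_one]
  rw [this, map_smul]
  exact W.smul_mem _ (hW _ b le_rfl)

/-- A component of the zero locus of `k` forms that is avoided by `c` linear forms has
`n < k + c`: at a point of its cone lying on no other component, the `k` forms and `c` translated linear
forms cut out the point, and Krull's height theorem applies. -/
theorem le_add_of_isComponent {k : ℕ} {F : Fin k → MvPolynomial (Fin (n + 1)) ℂ}
    (hF : ∀ i, ∃ e, (F i).IsHomogeneous e) {Y : Set (PSpace n)}
    (hY : IsComponent Y (zeroLocus (Set.range F)))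
    {u : Matrix (Fin c) (Fin (n + 1)) ℂ} (hu : Avoids Y u) : n + 1 ≤ k + c := by
  classical
  have hYv : IsVariety Y := hY.1.1.1
  have hYmin := coneIdeal_mem_minimalPrimes (by rintro _ ⟨i, rfl⟩; exact hF i) hY
  have hprime : (coneIdeal Y).IsPrime := hYmin.1.1
  set I := Ideal.span (Set.range F) with hI
  -- `g` vanishes on the other components
  obtain ⟨g, hg, hgY⟩ : ∃ g, (∀ q ∈ I.minimalPrimes, q ≠ coneIdeal Y → g ∈ q) ∧
      g ∉ coneIdeal Y := by
    have hfin : I.minimalPrimes.Finite := Ideal.finite_minimalPrimes_of_isNoetherianRing _ I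
    by_contra! h
    have h1 : (hfin.toFinset.erase (coneIdeal Y)).inf id ≤ coneIdeal Y := by
      intro g hg
      refine h g fun q hq hqY => ?_
      rw [Submodule.mem_finsetInf] at hg
      exact hg q (Finset.mem_erase.2 ⟨hqY, hfin.mem_toFinset.2 hq⟩)
    obtain ⟨q, hq, hqY⟩ := hprime.inf_le'.1 h1
    obtain ⟨hqY', hq⟩ := Finset.mem_erase.1 hq
    have hq := hfin.mem_toFinset.1 hq
    exact hqY' (le_antisymm hqY (hYmin.2 hq.1 hqY))
  obtain ⟨w, hw, hgw⟩ : ∃ w ∈ cone Y, eval w g ≠ 0 := by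
    by_contra! h
    exact hgY (mem_coneIdeal.2 h)
  let G : Fin c → MvPolynomial (Fin (n + 1)) ℂ := fun i => linForm u i - C (u.mulVec w i)
  let S : Finset (MvPolynomial (Fin (n + 1)) ℂ) := Finset.univ.image F ∪ Finset.univ.image G
  have hSF : ∀ i, F i ∈ S := fun i =>
    Finset.mem_union_left _ (Finset.mem_image_of_mem _ (Finset.mem_univ i))
  have hSG : ∀ i, G i ∈ S := fun i =>
    Finset.mem_union_right _ (Finset.mem_image_of_mem _ (Finset.mem_univ i))
  have hmw : (vanishingIdeal ℂ {w} : Ideal (MvPolynomial (Fin (n + 1)) ℂ)) ∈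
      (Ideal.span (S : Set (MvPolynomial (Fin (n + 1)) ℂ))).minimalPrimes := by
    refine ⟨⟨inferInstance, Ideal.span_le.2 fun H hH => ?_⟩, ?_⟩
    · rw [SetLike.mem_coe, mem_vanishingIdeal_singleton_iff]
      rcases Finset.mem_union.1 hH with hH | hH
      · obtain ⟨i, -, rfl⟩ := Finset.mem_image.1 hH
        exact mem_coneIdeal.1 (hYmin.1.2 (Ideal.subset_span ⟨i, rfl⟩)) w hw
      · obtain ⟨i, -, rfl⟩ := Finset.mem_image.1 hH
        change eval w (G i) = 0
        rw [map_sub, eval_linForm, eval_C, sub_self]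
    · rintro Q ⟨hQ, hSQ⟩ hQw
      have hIQ : I ≤ Q := Ideal.span_le.2 (by
        rintro _ ⟨i, rfl⟩
        exact hSQ (Ideal.subset_span (hSF i)))
      obtain ⟨q, hq, hqQ⟩ := Ideal.exists_minimalPrimes_le hIQ
      have hqY : q = coneIdeal Y := by
        by_contra hne
        exact hgw ((mem_vanishingIdeal_singleton_iff w g).1 (hQw (hqQ (hg q hq hne))))
      have hfin := finite_quotient_of_avoids hYv hu (u.mulVec w) (hqY ▸ hqQ)
        fun i => hSQ (Ideal.subset_span (hSG i))
      have hart : IsArtinianRing (MvPolynomial (Fin (n + 1)) ℂ ⧸ Q) := IsArtinianRing.of_finite ℂ _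
      have hmax : Q.IsMaximal := Ideal.Quotient.maximal_of_isField _
        (IsArtinianRing.isField_of_isDomain _)
      exact (hmax.eq_of_le (Ideal.IsPrime.ne_top inferInstance) hQw).ge
  have h1 := Ideal.height_le_card_of_mem_minimalPrimes_span_finset hmw
  have h2 : S.card ≤ k + c := by
    refine (Finset.card_union_le _ _).trans (add_le_add ?_ ?_)
    · simpa using Finset.card_image_le (s := Finset.univ) (f := F)
    · simpa using Finset.card_image_le (s := Finset.univ) (f := G)
  have h3 := (le_height_vanishingIdeal_singleton w).trans h1
  exact (by exact_mod_cast h3 : n + 1 ≤ S.card).trans h2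

end

/-! ### Independence modulo linear forms -/

section

/-- A matrix with `r` independent rows can be completed by `s` further rows to one with a left
inverse, when there are at most `r + s` columns. -/
theorem exists_mul_add_mul_eq_one {N r s : ℕ} (u : Matrix (Fin r) (Fin N) ℂ)
    (hu : LinearIndependent ℂ u.row) (hrs : N ≤ r + s) :
    ∃ (w : Matrix (Fin N) (Fin r) ℂ) (τ : Matrix (Fin N) (Fin s) ℂ) (β : Matrix (Fin s) (Fin N) ℂ),
      w * u + τ * β = 1 := by
  have hker : Module.finrank ℂ (LinearMap.ker u.mulVecLin) ≤ Module.finrank ℂ (Fin s → ℂ) := by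
    have h1 := LinearMap.finrank_range_add_finrank_ker u.mulVecLin
    have h2 : Module.finrank ℂ (LinearMap.range u.mulVecLin) = r := by
      have := hu.rank_matrix
      rwa [Fintype.card_fin] at this
    rw [h2] at h1
    simp only [Module.finrank_fin_fun] at h1 ⊢
    omega
  obtain ⟨j, hj⟩ := finrank_le_iff_exists_linearMap.1 hker
  obtain ⟨b, hb⟩ := LinearMap.exists_extend j
  have hinj : LinearMap.ker (u.mulVecLin.prod b) = ⊥ := by
    rw [LinearMap.ker_eq_bot']
    intro x hx
    rw [LinearMap.prod_apply, Function.prod_apply, Prod.mk_eq_zero] at hx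
    have h1 : j ⟨x, hx.1⟩ = 0 := by
      rw [← hb]
      exact hx.2
    have h2 := hj (h1.trans (map_zero j).symm)
    exact congrArg Subtype.val h2
  obtain ⟨q, hq⟩ := LinearMap.exists_leftInverse_of_injective _ hinj
  refine ⟨LinearMap.toMatrix' (q.comp (LinearMap.inl ℂ _ _)),
    LinearMap.toMatrix' (q.comp (LinearMap.inr ℂ _ _)), LinearMap.toMatrix' b, ?_⟩
  have hu' : u = LinearMap.toMatrix' u.mulVecLin := by
    rw [← Matrix.toLin'_apply', LinearMap.toMatrix'_toLin']
  conv_lhs => rw [hu']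
  rw [← LinearMap.toMatrix'_comp, ← LinearMap.toMatrix'_comp, ← map_add]
  rw [← LinearMap.toMatrix'_id]
  congr 1
  rw [← hq]
  refine LinearMap.ext fun x => ?_
  simp only [LinearMap.add_apply, LinearMap.comp_apply, ← map_add]
  congr 1
  simp

variable {N r s : ℕ} {A : Type} [CommRing A] [Algebra ℂ A]

theorem eq_sum_of_mul_add_mul_eq_one {w : Matrix (Fin N) (Fin r) ℂ} {u : Matrix (Fin r) (Fin N) ℂ}
    {τ : Matrix (Fin N) (Fin s) ℂ} {β : Matrix (Fin s) (Fin N) ℂ} (hone : w * u + τ * β = 1)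
    (y : Fin N → A) (l : Fin N) :
    y l = ∑ j, algebraMap ℂ A (w l j) * (∑ l', algebraMap ℂ A (u j l') * y l') +
      ∑ i, algebraMap ℂ A (τ l i) * (∑ l', algebraMap ℂ A (β i l') * y l') := by
  have h4 : ∀ l', ((w * u + τ * β) l l') = if l = l' then 1 else 0 := fun l' => by
    rw [hone, Matrix.one_apply]
  simp only [Finset.mul_sum]
  rw [Finset.sum_comm, Finset.sum_comm (s := (Finset.univ : Finset (Fin s))),
    ← Finset.sum_add_distrib]
  simp only [← mul_assoc, ← map_mul, ← Finset.sum_mul, ← map_sum, ← add_mul, ← map_add]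
  simp only [Matrix.add_apply, Matrix.mul_apply] at h4
  simp only [h4]
  simp

/-- If `r` linear combinations of the `y l` are algebraically independent, then subtracting from
the `y l` suitable linear forms in `s` variables makes them algebraically independent, when
`N ≤ r + s`. -/
theorem exists_independent_sub_linear (y : Fin N → A) (u : Matrix (Fin r) (Fin N) ℂ)
    (hu : ∀ W : MvPolynomial (Fin r) ℂ, aeval (fun i => ∑ l, algebraMap ℂ A (u i l) * y l) W = 0 →
      W = 0) (hrs : N ≤ r + s) :
    ∃ τ : Matrix (Fin N) (Fin s) ℂ, ∀ G : MvPolynomial (Fin N) ℂ,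
      aeval (fun l => (C (y l) - ∑ i, X i * C (algebraMap ℂ A (τ l i)) : MvPolynomial (Fin s) A)) G
        = 0 → G = 0 := by
  have hrow : LinearIndependent ℂ u.row := by
    rw [Fintype.linearIndependent_iff]
    intro g hg i
    have h1 := hu (∑ j, C (g j) * X j) (by
      simp only [map_sum, map_mul, aeval_X, ← algebraMap_eq, AlgHom.commutes, Finset.mul_sum]
      rw [Finset.sum_comm]
      refine Finset.sum_eq_zero fun l _ => ?_
      have h2 := congrFun hg l
      simp only [Finset.sum_apply, Pi.smul_apply, Matrix.row_apply, smul_eq_mul,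
        Pi.zero_apply] at h2
      simp only [← mul_assoc, ← map_mul, ← Finset.sum_mul, ← map_sum, h2, map_zero, zero_mul])
    have h3 := congrArg (coeff (Finsupp.single i 1)) h1
    simpa [coeff_sum, coeff_C_mul, coeff_X, Finsupp.single_left_inj] using h3
  obtain ⟨w, τ, β, hone⟩ := exists_mul_add_mul_eq_one u hrow hrs
  refine ⟨τ, fun G hG => ?_⟩
  -- the substitution `X i ↦ X i + ∑ l, β i l * y l` turns the elements into linear combinations,
  -- with matrix `(w, -τ)`, of the independent elements `u y` and `X i`
  let θ : MvPolynomial (Fin s) A →ₐ[A] MvPolynomial (Fin s) A :=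
    aeval fun i => X i + C (∑ l, algebraMap ℂ A (β i l) * y l)
  let ψ : MvPolynomial (Fin r) ℂ →ₐ[ℂ] A := aeval fun i => ∑ l, algebraMap ℂ A (u i l) * y l
  let T : MvPolynomial (Fin N) ℂ →ₐ[ℂ] MvPolynomial (Fin s) (MvPolynomial (Fin r) ℂ) :=
    aeval fun l => C (∑ j, C (w l j) * X j) - ∑ i, X i * C (C (τ l i))
  have hT : ∀ G, map ψ.toRingHom (T G) = θ (aeval (fun l => (C (y l) -
      ∑ i, X i * C (algebraMap ℂ A (τ l i)) : MvPolynomial (Fin s) A)) G) := by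
    intro G
    have : (map ψ.toRingHom).comp T.toRingHom = θ.toRingHom.comp (aeval (R := ℂ)
        (fun l => (C (y l) - ∑ i, X i * C (algebraMap ℂ A (τ l i)) :
          MvPolynomial (Fin s) A))).toRingHom := by
      refine MvPolynomial.ringHom_ext (fun z => ?_) fun l => ?_
      · have h1 : (T (C z) : MvPolynomial (Fin s) (MvPolynomial (Fin r) ℂ)) = C (C z) :=
          T.commutes z
        have h2 : aeval (R := ℂ) (fun l => (C (y l) -
            ∑ i, X i * C (algebraMap ℂ A (τ l i)) : MvPolynomial (Fin s) A)) (C z)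
            = C (algebraMap ℂ A z) := AlgHom.commutes _ z
        change map ψ.toRingHom (T (C z)) = θ (aeval (R := ℂ) _ (C z))
        rw [h1, h2, map_C]
        change C (ψ (C z)) = θ (algebraMap A _ (algebraMap ℂ A z))
        rw [θ.commutes]
        exact congrArg C (ψ.commutes z)
      · change map ψ.toRingHom (T (X l)) = θ (aeval (R := ℂ) _ (X l))
        have h1 : ∀ a : A, θ (C a) = C a := fun a => θ.commutes a
        have h2 : ∀ z, ψ (C z) = algebraMap ℂ A z := fun z => ψ.commutes z
        have h3 := eq_sum_of_mul_add_mul_eq_one hone y l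
        simp only [T, aeval_X, map_sub, map_C, map_sum, map_mul, map_X, h1]
        simp only [AlgHom.toRingHom_eq_coe, RingHom.coe_coe, h2]
        simp only [θ, ψ, aeval_X, add_mul, Finset.sum_add_distrib]
        rw [h3]
        simp only [map_add, map_sum, map_mul, mul_comm]
        ring
    exact congrArg (fun h => h G) this
  have hψ : Function.Injective ψ.toRingHom := (injective_iff_map_eq_zero _).2 hu
  have hTG : T G = 0 := by
    refine map_injective _ hψ ?_
    rw [hT, hG, map_zero, map_zero]
  refine MvPolynomial.funext fun x => ?_
  have hev : (eval (fun i => -∑ l, β i l * x l)).comp ((map (eval fun j => ∑ l, u j l * x l)).comp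
      T.toRingHom) = eval x := by
    refine MvPolynomial.ringHom_ext (fun z => ?_) fun l => ?_
    · have h1 : (T (C z) : MvPolynomial (Fin s) (MvPolynomial (Fin r) ℂ)) = C (C z) :=
        T.commutes z
      change eval _ (map _ (T (C z))) = _
      rw [h1]
      simp
    · change eval _ (map _ (T (X l))) = _
      have h3 := eq_sum_of_mul_add_mul_eq_one hone x l
      simp only [Algebra.algebraMap_self, RingHom.id_apply] at h3
      rw [eval_X, h3]
      simp only [T, aeval_X, map_sub, map_C, map_sum, map_mul, map_X, eval_C, eval_X, mul_comm]
      simp only [mul_neg, Finset.sum_neg_distrib, sub_neg_eq_add]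
  rw [← hev, map_zero]
  change eval _ (map _ (T G)) = 0
  rw [hTG, map_zero, map_zero]

end

/-! ### The obstruction vanishes on components of large dimension -/

section

variable {n m r s : ℕ}

/-- If the `y l` are algebraically independent modulo suitable linear forms in `s` variables, then
a point with coordinates `y l` lies on an affine space of dimension `s` with algebraically
independent parameters `M`: a base point and `s` directions. -/
theorem exists_independent_parametrization {A : Type} [CommRing A] [IsDomain A] [Algebra ℂ A]
    {N : ℕ} (y : Fin N → A) (τ : Matrix (Fin N) (Fin s) ℂ) (hτ : ∀ G : MvPolynomial (Fin N) ℂ,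
      aeval (fun l => (C (y l) - ∑ i, X i * C (algebraMap ℂ A (τ l i)) : MvPolynomial (Fin s) A)) G
        = 0 → G = 0) :
    ∃ M : Fin N × Fin (s + 1) → MvPolynomial (Fin N × Fin s) (MvPolynomial (Fin s) A),
      (∀ l, C (C (y l)) = M (l, 0) + ∑ i : Fin s, M (l, i.succ) * C (X i)) ∧
        ∀ G : MvPolynomial (Fin N × Fin (s + 1)) ℂ, aeval M G = 0 → G = 0 := by
  let v : Fin N → MvPolynomial (Fin N × Fin s) (MvPolynomial (Fin s) A) := fun l =>
    C (C (y l)) - ∑ i, C (X i) * X (l, i)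
  let g : Fin N × Fin (s + 1) → Fin N ⊕ Fin N × Fin s := fun li =>
    Fin.cases (Sum.inl li.1) (fun i => Sum.inr (li.1, i)) li.2
  have hg : Function.Injective g := by
    rintro ⟨l, i⟩ ⟨l', i'⟩ h
    induction i using Fin.cases <;> induction i' using Fin.cases <;> simp_all [g]
  refine ⟨fun li => Sum.elim v X (g li), fun l => ?_, fun G hG => ?_⟩
  · simp only [g, Fin.cases_zero, Fin.cases_succ, Sum.elim_inl, Sum.elim_inr, v]
    rw [sub_add_eq_add_sub, eq_sub_iff_add_eq]
    simp only [mul_comm]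
  · refine rename_injective g hg ?_
    rw [map_zero]
    refine aeval_eq_zero_of_specialization v (fun li => τ li.1 li.2) (fun G' hG' => hτ G' ?_) _ ?_
    · rw [← hG']
      congr 2
      funext l
      simp only [v, map_sub, map_sum, map_mul, eval_C, eval_X]
      rfl
    · rw [aeval_rename]
      exact hG

/-- Let the `s + 1` combinations given by `Λ` vanish on `Y`, but not all `f j`, and let the least
number `r` of linear forms avoiding `Y` be at least `n + 1 - s`. Then the obstruction `P` vanishes
at `Λ`, identically in its parameters: the generic point of the cone over `Y` lies on an affine
space of dimension `s` with algebraically independent parameters. -/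
theorem eval_obstruction_eq_zero {Y : Set (PSpace n)} (hY : IsIrredVariety Y)
    {u : Matrix (Fin r) (Fin (n + 1)) ℂ} (hu : Avoids Y u)
    (hmin : ∀ r' < r, ∀ u' : Matrix (Fin r') (Fin (n + 1)) ℂ, ¬ Avoids Y u') (hrs : n + 1 ≤ r + s)
    {f : Fin m → MvPolynomial (Fin (n + 1)) ℂ} {Λ : Matrix (Fin (s + 1)) (Fin m) ℂ}
    (hΛ : ∀ i, linComb Λ f i ∈ coneIdeal Y) (hne : ∃ j, f j ∉ coneIdeal Y)
    {P : MvPolynomial (Fin (s + 1) × Fin m) (MvPolynomial (Fin (n + 1) × Fin (s + 1)) ℂ)}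
    (hP : ∀ (E : Type) [CommRing E] [IsDomain E] [Algebra ℂ E]
      (M : Fin (n + 1) × Fin (s + 1) → E) (ξ : Fin s → E) (y : Fin (n + 1) → E)
      (_ : ∀ l, y l = M (l, 0) + ∑ i : Fin s, M (l, i.succ) * ξ i)
      (Λ : Matrix (Fin (s + 1)) (Fin m) ℂ), (∃ j, aeval y (f j) ≠ 0) →
      (∀ i, ∑ j, algebraMap ℂ E (Λ i j) * aeval y (f j) = 0) →
      eval₂ (aeval (R := ℂ) M).toRingHom (fun ij => algebraMap ℂ E (Λ ij.1 ij.2)) P = 0) :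
    eval (fun ij => C (Λ ij.1 ij.2)) P = 0 := by
  have hprime := coneIdeal_isPrime hY
  let A := MvPolynomial (Fin (n + 1)) ℂ ⧸ coneIdeal Y
  let y : Fin (n + 1) → A := fun l => Ideal.Quotient.mk _ (X l)
  have hy : ∀ F : MvPolynomial (Fin (n + 1)) ℂ,
      aeval y F = (Ideal.Quotient.mk (coneIdeal Y) F : A) := by
    intro F
    have : aeval (R := ℂ) y = Ideal.Quotient.mkₐ ℂ (coneIdeal Y) := by
      ext l
      rw [aeval_X]
      rfl
    rw [this]
    rfl
  have hform : ∀ i, ∑ l, algebraMap ℂ A (u i l) * y l = Ideal.Quotient.mk _ (linForm u i) := by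
    intro i
    rw [linForm, map_sum]
    simp only [map_mul]
    rfl
  obtain ⟨τ, hτ⟩ := exists_independent_sub_linear (s := s) y u (fun W hW => by
    refine eq_zero_of_aeval_linForm_mem hu hmin W (Ideal.Quotient.eq_zero_iff_mem.1 ?_)
    rw [← hW, ← Ideal.Quotient.mkₐ_eq_mk ℂ, ← AlgHom.comp_apply, comp_aeval]
    simp only [hform]
    rfl) hrs
  obtain ⟨M, hyM, hM⟩ := exists_independent_parametrization y τ hτ
  have hy' : ∀ F : MvPolynomial (Fin (n + 1)) ℂ,
      aeval (fun l => (C (C (y l)) :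
        MvPolynomial (Fin (n + 1) × Fin s) (MvPolynomial (Fin s) A))) F =
        C (C (Ideal.Quotient.mk (coneIdeal Y) F)) := by
    intro F
    rw [← hy]
    exact (aeval_algebraMap_apply (A := A) _ y F)
  have h1 := hP _ M (fun i => C (X i)) (fun l => C (C (y l))) hyM Λ (by
      obtain ⟨j, hj⟩ := hne
      refine ⟨j, fun h => hj (Ideal.Quotient.eq_zero_iff_mem.1 ?_)⟩
      rw [hy'] at h
      exact C_eq_zero.1 (C_eq_zero.1 h)) (fun i => by
      simp only [hy']
      have h2 := Ideal.Quotient.eq_zero_iff_mem.2 (hΛ i)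
      simp only [linComb, map_sum, smul_eq_C_mul, map_mul] at h2
      have h3 := congrArg (fun a : A => (C (C a) :
        MvPolynomial (Fin (n + 1) × Fin s) (MvPolynomial (Fin s) A))) h2
      simp only [map_sum, map_mul, map_zero] at h3
      exact h3)
  refine hM _ ?_
  rw [← h1]
  change (aeval M).toRingHom (eval₂ (RingHom.id _) _ P) = _
  rw [hom_eval₂, RingHom.comp_id]
  congr 1
  funext ij
  exact (aeval M).commutes _

end

/-! ### Hypersurfaces and the dimension of components -/

section

variable {n m k : ℕ}

/-- The zero set of a nonzero polynomial is contained in a hypersurface: that of its radical, or any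
hyperplane if it is empty. -/
theorem exists_hypersurface (hm : 1 ≤ m) (hk : 1 ≤ k) {p : MvPolynomial (Fin k × Fin m) ℂ}
    (hp : p ≠ 0) {D : ℕ} (hD : 1 ≤ D) (hpD : p.totalDegree ≤ D) :
    ∃ (H : Set (Matrix (Fin k) (Fin m) ℂ)) (e : ℕ), IsHypersurfaceOfDegree H e ∧ e ≤ D ∧
      ∀ Λ ∉ H, eval (fun ij => Λ ij.1 ij.2) p ≠ 0 := by
  classical
  by_cases h0 : p.totalDegree = 0
  · let x : Fin k × Fin m := (⟨0, hk⟩, ⟨0, hm⟩)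
    refine ⟨{Λ | eval (fun ij => Λ ij.1 ij.2) (X x : MvPolynomial (Fin k × Fin m) ℂ) = 0}, 1,
      ⟨X x, ?_, ?_, totalDegree_X _, rfl⟩, hD, fun Λ _ => ?_⟩
    · exact (X_prime (i := x)).squarefree
    · rw [totalDegree_X]; exact one_pos
    · rw [totalDegree_eq_zero_iff_eq_C.1 h0, eval_C]
      intro h
      exact hp (by rw [totalDegree_eq_zero_iff_eq_C.1 h0, h, map_zero])
  · let : StrongNormalizationMonoid (MvPolynomial (Fin k × Fin m) ℂ) :=
      UniqueFactorizationMonoid.strongNormalizationMonoid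
    let q := UniqueFactorizationMonoid.radical p
    have hq : Squarefree q := UniqueFactorizationMonoid.squarefree_radical
    obtain ⟨q', hq'⟩ : q ∣ p := UniqueFactorizationMonoid.radical_dvd_self
    obtain ⟨N, hN⟩ : ∃ N, p ∣ q ^ N :=
      UniqueFactorizationMonoid.exists_dvd_radical_self_pow hp
    have hq0 : q ≠ 0 := hq.ne_zero
    refine ⟨{Λ | eval (fun ij => Λ ij.1 ij.2) q = 0}, q.totalDegree, ⟨q, hq, ?_, rfl, rfl⟩, ?_,
      fun Λ hΛ h => hΛ ?_⟩
    · rw [Nat.pos_iff_ne_zero]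
      intro hq1
      obtain ⟨a, ha⟩ := hN
      have ha0 : a ≠ 0 := right_ne_zero_of_mul (ha ▸ pow_ne_zero N hq0)
      have h1 := totalDegree_pow q N
      rw [ha, totalDegree_mul_of_isDomain hp ha0, hq1, mul_zero] at h1
      omega
    · refine le_trans ?_ hpD
      rw [hq', totalDegree_mul_of_isDomain hq0 (right_ne_zero_of_mul (hq' ▸ hp))]
      exact Nat.le_add_right _ _
    · obtain ⟨a, ha⟩ := hN
      have h1 := congrArg (eval fun ij => Λ ij.1 ij.2) ha
      rw [map_mul, h, zero_mul, map_pow] at h1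
      exact eq_zero_of_pow_eq_zero h1

theorem exists_ker_mulVecLin_eq (L : Submodule ℂ (Fin (n + 1) → ℂ)) :
    ∃ (c : ℕ) (u : Matrix (Fin c) (Fin (n + 1)) ℂ), LinearMap.ker u.mulVecLin = L ∧
      c + Module.finrank ℂ L = n + 1 := by
  let b := Module.finBasis ℂ ((Fin (n + 1) → ℂ) ⧸ L)
  refine ⟨_, LinearMap.toMatrix' (b.equivFun.toLinearMap ∘ₗ L.mkQ), ?_, ?_⟩
  · rw [← Matrix.toLin'_apply', Matrix.toLin'_toMatrix', LinearEquiv.ker_comp, Submodule.ker_mkQ]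
  · rw [Submodule.finrank_quotient_add_finrank, Module.finrank_fin_fun]

theorem exists_avoids (Y : Set (PSpace n)) :
    ∃ (c : ℕ) (u : Matrix (Fin c) (Fin (n + 1)) ℂ), Avoids Y u :=
  ⟨n + 1, 1, fun v _ hv => by rwa [Matrix.one_mulVec] at hv⟩

/-- A component of the zero locus of `k` forms which is avoided by some `n + 1 - k` linear forms has
dimension `n - k`. -/
theorem hasDim_of_isComponent {F : Fin k → MvPolynomial (Fin (n + 1)) ℂ}
    (hF : ∀ i, ∃ e, (F i).IsHomogeneous e) {Y : Set (PSpace n)}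
    (hY : IsComponent Y (zeroLocus (Set.range F))) {r : ℕ}
    {u : Matrix (Fin r) (Fin (n + 1)) ℂ} (hu : Avoids Y u) {δ : ℕ} (hδ : δ + k = n)
    (hr : r ≤ δ + 1) : HasDim Y δ := by
  refine ⟨fun L hL => ?_, fun c hc _ => ?_⟩
  · by_contra hmeet
    obtain ⟨c, u', rfl, hc⟩ := exists_ker_mulVecLin_eq L
    have := le_add_of_isComponent hF hY (avoids_iff_not_meets.2 hmeet)
    omega
  · obtain ⟨u', hu'⟩ := hu.exists_of_le (hr.trans hc)
    obtain ⟨Q, hQ, hQu⟩ := exists_generic_avoids hY.1.1.1 hu'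
    exact ⟨Q, hQ, fun u hu => avoids_iff_not_meets.1 (hQu u hu)⟩

end

end ProjVar


open MvPolynomial in
theorem mainTheorem11 (n m k d : ℕ) (hm : 1 ≤ m) (hk : 1 ≤ k) (hd : 1 ≤ d)
    (f : Fin m → MvPolynomial (Fin (n + 1)) ℂ) (hf : ∀ i, (f i).IsHomogeneous d) :
    ∃ (H : Set (Matrix (Fin k) (Fin m) ℂ)) (e : ℕ),
      ProjVar.IsHypersurfaceOfDegree H e ∧ e ≤ k * d ^ (k - 1) ∧
      ∀ Λ : Matrix (Fin k) (Fin m) ℂ, Λ ∉ H →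
        ∀ Y : Set (ProjVar.PSpace n),
          ProjVar.IsComponent Y (ProjVar.projV (ProjVar.linComb Λ f)) →
            ProjVar.IsComponent Y (ProjVar.projV f) ∨
            ∃ r : ℕ, r + k = n ∧ ProjVar.HasDim Y r := by
  obtain ⟨s, rfl⟩ : ∃ s, k = s + 1 := ⟨k - 1, by omega⟩
  obtain ⟨P, hP0, hPdeg, hP⟩ := ProjVar.exists_obstruction s hd f fun j => (hf j).totalDegree_le
  -- specialise the parameters of the generic affine space
  obtain ⟨M, hM⟩ : ∃ M : Fin (n + 1) × Fin (s + 1) → ℂ, map (eval M) P ≠ 0 := by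
    obtain ⟨a, ha⟩ := MvPolynomial.ne_zero_iff.1 hP0
    obtain ⟨M, hM⟩ : ∃ M, eval M (coeff a P) ≠ 0 := by
      by_contra! h
      exact ha (MvPolynomial.funext fun M => by rw [h, map_zero])
    refine ⟨M, fun h => hM ?_⟩
    rw [← coeff_map, h, coeff_zero]
  have hMdeg : (map (eval M) P).totalDegree ≤ (s + 1) * d ^ s :=
    (Finset.sup_mono (support_map_subset _ _)).trans hPdeg
  obtain ⟨H, e, hHe, heD, hH⟩ := ProjVar.exists_hypersurface hm hk hM
    (D := (s + 1) * d ^ s) (Nat.mul_pos hk (pow_pos hd s)) hMdeg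
  refine ⟨H, e, hHe, heD, fun Λ hΛ Y hY => ?_⟩
  have hPΛ : eval (fun ij => C (Λ ij.1 ij.2)) P ≠ 0 := by
    intro h
    refine hH Λ hΛ ?_
    have h1 := congrArg (eval M) h
    rw [map_zero, ← eval₂_id P, hom_eval₂, RingHom.comp_id] at h1
    rw [eval_map, ← h1]
    congr 1
    funext ij
    exact (eval_C _).symm
  have hhom : ∀ i, (ProjVar.linComb Λ f i).IsHomogeneous d := fun i =>
    IsHomogeneous.sum _ _ _ fun j _ => by
      rw [smul_eq_C_mul]
      simpa using (isHomogeneous_C _ (Λ i j)).mul (hf j)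
  have hfS : ∀ F ∈ Set.range f, ∃ e : ℕ, F.IsHomogeneous e := by
    rintro _ ⟨j, rfl⟩
    exact ⟨d, hf j⟩
  have hsub : ProjVar.projV f ⊆ ProjVar.projV (ProjVar.linComb Λ f) := by
    rintro p hp _ ⟨i, rfl⟩
    simp only [ProjVar.linComb, map_sum, smul_eq_C_mul, map_mul]
    exact Finset.sum_eq_zero fun j _ => by rw [hp _ ⟨j, rfl⟩, mul_zero]
  by_cases hYV : Y ⊆ ProjVar.projV f
  · exact Or.inl ⟨⟨hY.1.1, hYV⟩, fun Z hZ hYZ => hY.2 ⟨hZ.1, hZ.2.trans hsub⟩ hYZ⟩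
  right
  have hΛY : ∀ i, ProjVar.linComb Λ f i ∈ ProjVar.coneIdeal Y := fun i =>
    (ProjVar.coneIdeal_mem_minimalPrimes (by rintro _ ⟨i, rfl⟩; exact ⟨d, hhom i⟩) hY).1.2
      (Ideal.subset_span ⟨i, rfl⟩)
  have hne : ∃ j, f j ∉ ProjVar.coneIdeal Y := by
    by_contra! h
    refine hYV fun p hp => ?_
    rintro _ ⟨j, rfl⟩
    exact ProjVar.mem_coneIdeal.1 (h j) _ (ProjVar.rep_mem_cone hp)
  classical
  -- the least number `r` of linear forms avoiding `Y`
  have hex := ProjVar.exists_avoids Y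
  obtain ⟨u, hu⟩ := Nat.find_spec hex
  have hmin := fun r' (hr' : r' < Nat.find hex) u' hu' => Nat.find_min hex hr' ⟨u', hu'⟩
  generalize Nat.find hex = r at u hu hmin
  -- otherwise the equation would vanish at `Λ` identically in the parameters
  have hrk : r + (s + 1) ≤ n + 1 := by
    by_contra hlt
    exact hPΛ (ProjVar.eval_obstruction_eq_zero hY.1.1 hu hmin (by omega) hΛY hne hP)
  have hr : r ≠ 0 := by
    rintro rfl
    obtain ⟨p, hp⟩ := hY.1.1.2.1
    exact p.rep_nonzero (hu p.rep (ProjVar.rep_mem_cone hp) (Subsingleton.elim _ _))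
  exact ⟨n - (s + 1), by omega,
    ProjVar.hasDim_of_isComponent (fun i => ⟨d, hhom i⟩) hY hu (by omega) (by omega)⟩
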